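/- **Ordinals.** For $n\in\mathbb N$ and an ordinal $\alpha$, write $\alpha=\omega^n\gamma+\delta$ with $\delta<\omega^n$ and put $\tau_n(\alpha)=\omega^n\cdot\min(\gamma,1)+\delta$. Ordinals $\alpha,\beta$ are $n$-equivalent, $\alpha\approx_n\beta$, if $\tau_n(\alpha)=\tau_n(\beta)$. **Automata.** A simple ordinal automaton with acceptance conditions and finite basis $B$ consists of $Q\subseteq\mathcal P(B)$, $\delta_{next}\subseteq Q\times Q$, $\delta_{lim}\subseteq\mathcal P(B)\times Q$, $I,F\subseteq Q$ and $\mathcal F\subseteq\mathcal P(B)$. For a map $r:\alpha\to Q$ and a limit ordinal $\beta\le\alpha$ let $B_{lim}(r,\beta)=\{a\in B:\exists\gamma<\beta\ \forall\gamma'\in(\gamma,\beta)\ a\in r(\gamma')\}$. An accepting run of length $\alpha>0$ is a map $r:\alpha\to Q$ such that $(r(\beta),r(\beta+1))\in\delta_{next}$ whenever $\beta+1<\alpha$; $(B_{lim}(r,\beta),r(\beta))\in\delta_{lim}$ for every limit ordinal $\beta<\alpha$; $r(0)\in I$; and $r(\alpha-1)\in F$ if $\alpha$ is a successor, $B_{lim}(r,\alpha)\in\mathcal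 F$ if $\alpha$ is a limit. **Logic.** Formulae of $\mathrm{LTL}(\mathsf U,\mathsf S)$ over a set $AP$ of atomic propositions are given by $\varphi::=p\mid\neg\varphi\mid\varphi\wedge\varphi\mid\varphi\,\mathsf U\,\varphi\mid\varphi\,\mathsf S\,\varphi$ with $p\in AP$. For $\sigma:\alpha\to\mathcal P(AP)$ and $\beta<\alpha$: $\sigma,\beta\models p$ iff $p\in\sigma(\beta)$; Boolean connectives are as usual; $\sigma,\beta\models\varphi_1\mathsf U\varphi_2$ iff there is $\gamma\in(\beta,\alpha)$ with $\sigma,\gamma\models\varphi_2$ and $\sigma,\gamma'\models\varphi_1$ for all $\gamma'\in(\beta,\gamma)$; $\sigma,\beta\models\varphi_1\mathsf S\varphi_2$ iff there is $\gamma<\beta$ with $\sigma,\gamma\models\varphi_2$ and $\sigma,\gamma'\models\varphi_1$ for all $\gamma'\in(\gamma,\beta)$. The formula $\varphi$ has an $\alpha$-model if $\alpha\ne0$ and $\sigma,0\models\varphi$ for some $\sigma:\alpha\to\mathcal P(AP)$. The size $|\varphi|$ is the number of elements of the set of all subformulae of $\varphi$ and their negations, where $\neg\neg\psi$ is identified with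 $\psi$. **Lemma 2.7.** (I) Let $\mathcal A$ be a simple ordinal automaton with acceptance conditions and finite basis $B$, and let $\alpha,\beta$ be countable ordinals with $\alpha\approx_{|B|+2}\beta$. Then $\mathcal A$ has an accepting run of length $\alpha$ iff it has an accepting run of length $\beta$. (II) Let $\varphi$ be a formula of $\mathrm{LTL}(\mathsf U,\mathsf S)$ and let $\alpha,\beta$ be countable ordinals with $\alpha\approx_{|\varphi|+2}\beta$. Then $\varphi$ has an $\alpha$-model iff it has a $\beta$-model. -/

import Mathlib

open Cardinal Ordinal

universe u v w

/-! ## Ordinals: truncation -/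

/-- The truncation of an ordinal: write `α = ω ^ n * γ + δ` with `δ < ω ^ n` (so `γ = α / ω ^ n`
and `δ = α % ω ^ n`); the truncation is `ω ^ n * min γ 1 + δ`. -/
noncomputable def ordTruncation (n : ℕ) (α : Ordinal.{u}) : Ordinal.{u} :=
  ω ^ n * min (α / ω ^ n) 1 + α % ω ^ n

/-- `n`-equivalence of ordinals: equal truncations. -/
def OrdEquiv (n : ℕ) (α β : Ordinal.{u}) : Prop :=
  ordTruncation n α = ordTruncation n β

/-! ## Simple ordinal automata -/

/-- A simple ordinal automaton with basis `B`. Locations are subsets of the basis. (The basis is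
required to be finite where the automata are used.) -/
structure SimpleOrdinalAutomaton (B : Type v) where
  /-- The set of locations. -/
  Q : Set (Set B)
  /-- The next-step transition relation, a subset of `Q × Q`. -/
  next : Set (Set B × Set B)
  next_subset : next ⊆ Q ×ˢ Q
  /-- The limit transition relation, a subset of `𝒫(B) × Q`. -/
  lim : Set (Set B × Set B)
  lim_subset : lim ⊆ Set.univ ×ˢ Q

/-- A simple ordinal automaton with acceptance conditions. -/
structure AcceptingOrdinalAutomaton (B : Type v) extends SimpleOrdinalAutomaton B where
  /-- The set of initial locations. -/
  I : Set (Set B)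
  I_subset : I ⊆ Q
  /-- The set of final locations, for runs of successor length. -/
  F : Set (Set B)
  F_subset : F ⊆ Q
  /-- The acceptance condition for runs of limit length. -/
  limF : Set (Set B)

/-- `B_lim(r, β)`: the elements of the basis that belong to every location of the `α`-sequence `r`
strictly between some `γ < β` and `β`. It is meant for limit ordinals `β ≤ α`; for `β = α` it is
`B_lim(r)`. -/
def limitSet {B : Type v} {α : Ordinal.{u}} (r : Set.Iio α → Set B) (β : Ordinal.{u}) : Set B :=
  {a | ∃ γ : Set.Iio α, γ.1 < β ∧ ∀ γ' : Set.Iio α, γ < γ' → γ'.1 < β → a ∈ r γ'}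

/-- `r` is an `α`-path of the automaton `A`. -/
structure SimpleOrdinalAutomaton.IsPath {B : Type v} (A : SimpleOrdinalAutomaton B)
    {α : Ordinal.{u}} (r : Set.Iio α → Set B) : Prop where
  pos : 0 < α
  mem_Q : ∀ β, r β ∈ A.Q
  next_mem : ∀ β γ : Set.Iio α, γ.1 = β.1 + 1 → (r β, r γ) ∈ A.next
  lim_mem : ∀ β : Set.Iio α, Order.IsSuccLimit β.1 → (limitSet r β.1, r β) ∈ A.lim

/-- `r` is an accepting run of length `α` of the automaton `A`. -/
structure AcceptingOrdinalAutomaton.IsAcceptingRun {B : Type v} (A : AcceptingOrdinalAutomaton B)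
    {α : Ordinal.{u}} (r : Set.Iio α → Set B) : Prop extends
    A.toSimpleOrdinalAutomaton.IsPath r where
  initial : r ⟨0, pos⟩ ∈ A.I
  final : ∀ β : Set.Iio α, α = β.1 + 1 → r β ∈ A.F
  limit : Order.IsSuccLimit α → limitSet r α ∈ A.limF

/-- `A` has an accepting run of length `α`. -/
def AcceptingOrdinalAutomaton.HasAcceptingRun {B : Type v} (A : AcceptingOrdinalAutomaton B)
    (α : Ordinal.{u}) : Prop :=
  ∃ r : Set.Iio α → Set B, A.IsAcceptingRun r

/-! ## The logic LTL(U,S) over ordinals -/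

/-- Formulae of LTL(U,S) over the set `AP` of atomic propositions. -/
inductive LTLFormula (AP : Type w) : Type w
  | atom (p : AP) : LTLFormula AP
  | neg (φ : LTLFormula AP) : LTLFormula AP
  | and (φ ψ : LTLFormula AP) : LTLFormula AP
  | U (φ ψ : LTLFormula AP) : LTLFormula AP
  | S (φ ψ : LTLFormula AP) : LTLFormula AP

namespace LTLFormula

variable {AP : Type w}

/-- Satisfaction of a formula at position `β < α` of the `α`-model `σ`, with strict "until" and
"since". -/
def Sat {α : Ordinal.{u}} (σ : Set.Iio α → Set AP) : Set.Iio α → LTLFormula AP → Prop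
  | β, atom p => p ∈ σ β
  | β, neg φ => ¬ Sat σ β φ
  | β, and φ ψ => Sat σ β φ ∧ Sat σ β ψ
  | β, U φ ψ => ∃ γ, β < γ ∧ Sat σ γ ψ ∧ ∀ γ', β < γ' → γ' < γ → Sat σ γ' φ
  | β, S φ ψ => ∃ γ, γ < β ∧ Sat σ γ ψ ∧ ∀ γ', γ < γ' → γ' < β → Sat σ γ' φ

/-- `φ` has an `α`-model: `α ≠ 0` and some `σ : α → 𝒫(AP)` satisfies `φ` at position `0`. -/
def HasModel (φ : LTLFormula AP) (α : Ordinal.{u}) : Prop :=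
  ∃ (h : 0 < α) (σ : Set.Iio α → Set AP), Sat σ ⟨0, h⟩ φ

/-- The set of subformulae of a formula (itself included), as plain syntax trees. -/
def subformulas : LTLFormula AP → Set (LTLFormula AP)
  | atom p => {atom p}
  | neg φ => insert (neg φ) (subformulas φ)
  | and φ ψ => insert (and φ ψ) (subformulas φ ∪ subformulas ψ)
  | U φ ψ => insert (U φ ψ) (subformulas φ ∪ subformulas ψ)
  | S φ ψ => insert (S φ ψ) (subformulas φ ∪ subformulas ψ)

/-- Negation up to the identification of `¬¬ψ` with `ψ`. -/
def cneg : LTLFormula AP → LTLFormula AP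
  | neg φ => φ
  | φ => neg φ

/-- The representative without double negations of a formula, where `¬¬ψ` is identified
with `ψ` everywhere in a formula. -/
def norm : LTLFormula AP → LTLFormula AP
  | atom p => atom p
  | neg φ => cneg (norm φ)
  | and φ ψ => and (norm φ) (norm ψ)
  | U φ ψ => U (norm φ) (norm ψ)
  | S φ ψ => S (norm φ) (norm ψ)

/-- `sub(φ)`: the subformulae of `φ` and their negations, where `¬¬ψ` is identified with `ψ`. -/
def sub (φ : LTLFormula AP) : Set (LTLFormula AP) :=
  norm '' (subformulas φ ∪ neg '' subformulas φ)

theorem finite_subformulas (φ : LTLFormula AP) : (subformulas φ).Finite := by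
  induction φ with
  | atom p => exact Set.finite_singleton _
  | neg φ ih => exact ih.insert _
  | and φ ψ ih₁ ih₂ => exact (ih₁.union ih₂).insert _
  | U φ ψ ih₁ ih₂ => exact (ih₁.union ih₂).insert _
  | S φ ψ ih₁ ih₂ => exact (ih₁.union ih₂).insert _

theorem finite_sub (φ : LTLFormula AP) : (sub φ).Finite :=
  ((finite_subformulas φ).union ((finite_subformulas φ).image _)).image _

/-- The size of `φ`: the cardinality of the finite set `sub(φ)`. -/
noncomputable def size (φ : LTLFormula AP) : ℕ := (sub φ).ncard

end LTLFormula

/-! A path of limit length is summarised by a triple (q, V, L): its first location, the intersection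
of its locations and its limit set (`Realizes`). Summaries are compositional: parts joined by limit
transitions can be replaced by other paths with the same summaries, and in an ω-sum of blocks the
new L consists of the elements of all but finitely many V's. What follows a path of limit length
sees only L. So (I) reduces to this: for n = |B| + 2 and every countable γ > 0, ω^n and ω^n * γ
realise the same triples.

The pumping is governed by the number of basis elements outside L. Beyond some proper initial part,
all locations of a path of length ω^(k+2) contain L (`exists_pure_tail`). Cut this tail at the
multiples of ω^(k+1). Either L is the limit set at one of them (`pure_cases`); then the path may
stop there, or the rest, entered from L and leading to L, may be repeated (`loop`). Or all these
limit sets strictly contain L, and the induction hypothesis applies to every block. Shortening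
yields `exists_shorter` and from it `contract`; lengthening yields `expand`. Initial parts are
absorbed by larger powers of ω.

(II) follows from (I) through an automaton with basis `sub φ` whose runs label each position with
the formulae true there. This works because strict until and since are determined by conditions on
successor steps, limit sets and the two ends (`IsUntil.iff`, `IsSince.iff`). -/

theorem Ordinal.exists_cofinal_seq {α : Ordinal.{u}} (hα : Order.IsSuccLimit α)
    (hc : α.card ≤ ℵ₀) :
    ∃ s : ℕ → Ordinal.{u}, s 0 = 0 ∧ StrictMono s ∧ (∀ j, s j < α) ∧ ∀ x < α, ∃ j, x < s j := by
  have h0 : 0 < α := hα.bot_lt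
  have : Countable (Set.Iio α) := by
    rw [← Cardinal.mk_le_aleph0_iff, Cardinal.mk_Iio_ordinal]
    exact Cardinal.lift_le_aleph0.2 hc
  have : Nonempty (Set.Iio α) := ⟨⟨0, h0⟩⟩
  obtain ⟨f, hf⟩ := exists_surjective_nat (Set.Iio α)
  let s : ℕ → Ordinal.{u} := fun n => Nat.rec 0 (fun i x => Order.succ (max x (f i).1)) n
  have hs : ∀ n, s (n + 1) = Order.succ (max (s n) (f n).1) := fun n => rfl
  refine ⟨s, rfl, strictMono_nat_of_lt_succ fun n => ?_, fun n => ?_, fun x hx => ?_⟩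
  · rw [hs]; exact Order.lt_succ_of_le (le_max_left _ _)
  · induction n with
    | zero => exact h0
    | succ n ih => rw [hs]; exact hα.succ_lt (max_lt ih (f n).2)
  · obtain ⟨n, hn⟩ := hf ⟨x, hx⟩
    refine ⟨n + 1, ?_⟩
    rw [hs, hn]
    exact Order.lt_succ_of_le (le_max_right _ _)

/-! ### Paths as total functions on the ordinals; values beyond the length are irrelevant. -/

section Paths

variable {B : Type v}

/-- The elements of the basis that belong to all `r x` for `x < β` large enough. -/
def eventualSet (r : Ordinal.{u} → Set B) (β : Ordinal.{u}) : Set B :=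
  {a | ∃ γ < β, ∀ x, γ < x → x < β → a ∈ r x}

/-- The restriction of `r` to the ordinals below `α` obeys the transition relations of `A`. -/
structure SimpleOrdinalAutomaton.PathOn (A : SimpleOrdinalAutomaton B)
    (r : Ordinal.{u} → Set B) (α : Ordinal.{u}) : Prop where
  mem_Q : ∀ β < α, r β ∈ A.Q
  next_mem : ∀ β, β + 1 < α → (r β, r (β + 1)) ∈ A.next
  lim_mem : ∀ β < α, Order.IsSuccLimit β → (eventualSet r β, r β) ∈ A.lim

theorem eventualSet_congr {r r' : Ordinal.{u} → Set B} {β : Ordinal.{u}}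
    (h : ∀ x < β, r x = r' x) : eventualSet r β = eventualSet r' β := by
  ext a
  constructor
  · rintro ⟨γ, hγ, H⟩
    exact ⟨γ, hγ, fun x h1 h2 => h x h2 ▸ H x h1 h2⟩
  · rintro ⟨γ, hγ, H⟩
    exact ⟨γ, hγ, fun x h1 h2 => (h x h2).symm ▸ H x h1 h2⟩

theorem eventualSet_add (r : Ordinal.{u} → Set B) (α : Ordinal.{u}) {β : Ordinal.{u}}
    (hβ : 0 < β) : eventualSet r (α + β) = eventualSet (fun x => r (α + x)) β := by
  ext a
  constructor
  · rintro ⟨γ, hγ, H⟩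
    refine ⟨γ - α, ?_, fun x h1 h2 => H _ ?_ ?_⟩
    · rcases le_total α γ with h | h
      · rwa [← Ordinal.add_sub_cancel_of_le h, add_lt_add_iff_left] at hγ
      · rwa [Ordinal.sub_eq_zero_iff_le.2 h]
    · rcases le_total α γ with h | h
      · rwa [← Ordinal.add_sub_cancel_of_le h, add_lt_add_iff_left]
      · rw [Ordinal.sub_eq_zero_iff_le.2 h] at h1
        exact h.trans_lt (lt_add_of_pos_right _ h1)
    · simpa using h2
  · rintro ⟨γ, hγ, H⟩
    refine ⟨α + γ, by simpa using hγ, fun x h1 h2 => ?_⟩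
    have hx : α ≤ x := le_self_add.trans h1.le
    rw [← Ordinal.add_sub_cancel_of_le hx] at h1 h2 ⊢
    exact H _ (by simpa using h1) (by simpa using h2)

namespace SimpleOrdinalAutomaton.PathOn

variable {A : SimpleOrdinalAutomaton B} {r r' : Ordinal.{u} → Set B} {α β : Ordinal.{u}}

theorem congr (h : ∀ x < α, r x = r' x) (H : A.PathOn r α) : A.PathOn r' α where
  mem_Q β hβ := h β hβ ▸ H.mem_Q β hβ
  next_mem β hβ := by
    rw [← h _ hβ, ← h _ (lt_of_le_of_lt le_self_add hβ)]
    exact H.next_mem β hβ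
  lim_mem β hβ hl := by
    rw [← h _ hβ, ← eventualSet_congr fun x hx => h x (hx.trans hβ)]
    exact H.lim_mem β hβ hl

theorem mono (h : β ≤ α) (H : A.PathOn r α) : A.PathOn r β where
  mem_Q x hx := H.mem_Q x (hx.trans_le h)
  next_mem x hx := H.next_mem x (hx.trans_le h)
  lim_mem x hx := H.lim_mem x (hx.trans_le h)

theorem tail (H : A.PathOn r (α + β)) : A.PathOn (fun x => r (α + x)) β where
  mem_Q x hx := H.mem_Q _ (by simpa using hx)
  next_mem x hx := by
    have := H.next_mem (α + x) (by rw [add_assoc]; simpa using hx)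
    rwa [add_assoc] at this
  lim_mem x hx hl := by
    rw [← eventualSet_add r α hl.bot_lt]
    refine H.lim_mem _ (by simpa using hx) ?_
    exact Ordinal.isSuccLimit_add α hl

/-- No successor step crosses a limit ordinal, so the limit transition at `α` is the only condition
linking the two parts. -/
theorem append (hα : Order.IsSuccLimit α) (h1 : A.PathOn r α)
    (h2 : A.PathOn (fun x => r (α + x)) β) (h3 : (eventualSet r α, r α) ∈ A.lim) :
    A.PathOn r (α + β) where
  mem_Q x hx := by
    rcases lt_or_ge x α with h | h
    · exact h1.mem_Q x h
    · rw [← Ordinal.add_sub_cancel_of_le h] at hx ⊢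
      exact h2.mem_Q _ (by simpa using hx)
  next_mem x hx := by
    rcases lt_or_ge x α with h | h
    · exact h1.next_mem x (hα.add_one_lt h)
    · rw [← Ordinal.add_sub_cancel_of_le h, add_assoc] at hx ⊢
      exact h2.next_mem _ (by simpa using hx)
  lim_mem x hx hl := by
    rcases lt_trichotomy x α with h | rfl | h
    · exact h1.lim_mem x h hl
    · exact h3
    · have h0 : 0 < x - α := by simpa [Ordinal.lt_sub] using h
      rw [← Ordinal.add_sub_cancel_of_le h.le] at hx hl ⊢
      rw [eventualSet_add r α h0]
      refine h2.lim_mem _ (by simpa using hx) ?_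
      exact ((Ordinal.isSuccLimit_add_iff).1 hl).resolve_right fun h => h0.ne' h.1

theorem of_cofinal (h : ∀ x < α, ∃ y, x < y ∧ A.PathOn r y) : A.PathOn r α where
  mem_Q x hx := by
    obtain ⟨y, hy, H⟩ := h x hx
    exact H.mem_Q x hy
  next_mem x hx := by
    obtain ⟨y, hy, H⟩ := h _ hx
    exact H.next_mem x hy
  lim_mem x hx := by
    obtain ⟨y, hy, H⟩ := h x hx
    exact H.lim_mem x hy

end SimpleOrdinalAutomaton.PathOn

/-- Gluing countably many sequences, the `j`-th one placed at positions `s j + x` with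
`s j + x < s (j + 1)`. -/
theorem exists_glue {X : Type*} {s : ℕ → Ordinal.{u}} (hs : StrictMono s)
    (f : ℕ → Ordinal.{u} → X) :
    ∃ r : Ordinal.{u} → X, ∀ j x, s j + x < s (j + 1) → r (s j + x) = f j x := by
  classical
  -- The least such i is the index of the block containing y.
  refine ⟨fun y => if h : ∃ i, y < s (i + 1) then f (Nat.find h) (y - s (Nat.find h))
    else f 0 0, fun j x hx => ?_⟩
  have h : ∃ i, s j + x < s (i + 1) := ⟨j, hx⟩
  have hj : Nat.find h = j := by
    rw [Nat.find_eq_iff]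
    refine ⟨hx, fun i hi => ?_⟩
    rw [not_lt]
    exact (hs.monotone (Nat.succ_le_of_lt hi)).trans le_self_add
  simp only [dif_pos h, hj, Ordinal.add_sub_cancel]

end Paths

/-! ### Sums of ω many positive ordinals. -/

/-- The sum of the first `j` terms of a sequence of ordinals. -/
noncomputable def partialSum (l : ℕ → Ordinal.{u}) : ℕ → Ordinal.{u}
  | 0 => 0
  | j + 1 => partialSum l j + l j

/-- `α` is the sum of the sequence `l` of positive ordinals. -/
structure IsOmegaSum (l : ℕ → Ordinal.{u}) (α : Ordinal.{u}) : Prop where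
  pos : ∀ j, 0 < l j
  lt : ∀ j, partialSum l j < α
  exists_lt : ∀ x < α, ∃ j, x < partialSum l j

theorem strictMono_partialSum {l : ℕ → Ordinal.{u}} (h : ∀ j, 0 < l j) :
    StrictMono (partialSum l) :=
  strictMono_nat_of_lt_succ fun j => lt_add_of_pos_right _ (h j)

namespace IsOmegaSum

variable {l : ℕ → Ordinal.{u}} {α : Ordinal.{u}}

theorem strictMono (h : IsOmegaSum l α) : StrictMono (partialSum l) :=
  strictMono_partialSum h.pos

theorem isSuccLimit (h : IsOmegaSum l α) : Order.IsSuccLimit α := by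
  rw [Ordinal.isSuccLimit_iff]
  refine ⟨((zero_le).trans_lt (h.lt 0)).ne', ?_⟩
  refine Order.isSuccPrelimit_of_succ_lt fun x hx => ?_
  obtain ⟨j, hj⟩ := h.exists_lt x hx
  exact (Order.succ_le_of_lt hj).trans_lt (h.lt j)

theorem exists_eq (h : IsOmegaSum l α) {x : Ordinal.{u}} (hx : x < α) :
    ∃ j, ∃ y < l j, x = partialSum l j + y := by
  classical
  have H := h.exists_lt x hx
  obtain ⟨j, hj⟩ : ∃ j, Nat.find H = j + 1 := by
    refine Nat.exists_eq_succ_of_ne_zero fun h0 => ?_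
    have := Nat.find_spec H
    rw [h0] at this
    exact not_lt_zero this
  have h1 : partialSum l j ≤ x := not_lt.1 (Nat.find_min H (by omega))
  have h2 : x < partialSum l j + l j := by
    have := Nat.find_spec H
    rwa [hj] at this
  refine ⟨j, x - partialSum l j, ?_, (Ordinal.add_sub_cancel_of_le h1).symm⟩
  rwa [← Ordinal.add_sub_cancel_of_le h1, add_lt_add_iff_left] at h2

end IsOmegaSum

/-! ### Summaries of paths and their composition. -/

section Types

variable {B : Type v}

/-- The elements of the basis that belong to `r x` for all `x < α`. -/
def alwaysSet (r : Ordinal.{u} → Set B) (α : Ordinal.{u}) : Set B :=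
  {a | ∀ x < α, a ∈ r x}

/-- The elements that belong to all but finitely many members of a sequence of sets. -/
def eventually (V : ℕ → Set B) : Set B :=
  {a | ∃ n, ∀ j, n ≤ j → a ∈ V j}

theorem alwaysSet_add (r : Ordinal.{u} → Set B) (α β : Ordinal.{u}) :
    alwaysSet r (α + β) = alwaysSet r α ∩ alwaysSet (fun x => r (α + x)) β := by
  ext a
  constructor
  · exact fun h => ⟨fun x hx => h x (hx.trans_le le_self_add), fun x hx => h _ (by simpa using hx)⟩
  · rintro ⟨h1, h2⟩ x hx
    rcases lt_or_ge x α with h | h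
    · exact h1 x h
    · rw [← Ordinal.add_sub_cancel_of_le h] at hx ⊢
      exact h2 _ (by simpa using hx)

theorem alwaysSet_congr {r r' : Ordinal.{u} → Set B} {β : Ordinal.{u}}
    (h : ∀ x < β, r x = r' x) : alwaysSet r β = alwaysSet r' β := by
  ext a
  exact forall₂_congr fun x hx => by rw [h x hx]

namespace IsOmegaSum

variable {l : ℕ → Ordinal.{u}} {α : Ordinal.{u}} (h : IsOmegaSum l α) (r : Ordinal.{u} → Set B)

include h

theorem alwaysSet_eq :
    alwaysSet r α = ⋂ j, alwaysSet (fun x => r (partialSum l j + x)) (l j) := by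
  ext a
  simp only [Set.mem_iInter]
  constructor
  · exact fun H j x hx => H _ (((add_lt_add_iff_left _).2 hx).trans (h.lt (j + 1)))
  · intro H x hx
    obtain ⟨j, y, hy, rfl⟩ := h.exists_eq hx
    exact H j y hy

/-- Final segments starting at block boundaries are cofinal among all final segments. So the limit
set depends only on the intersections of the blocks, which is why summaries record V. -/
theorem eventualSet_eq :
    eventualSet r α = eventually fun j => alwaysSet (fun x => r (partialSum l j + x)) (l j) := by
  ext a
  constructor
  · rintro ⟨γ, hγ, H⟩
    obtain ⟨n, hn⟩ := h.exists_lt γ hγ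
    refine ⟨n, fun j hj x hx => H _ ?_ ?_⟩
    · exact (hn.trans_le (h.strictMono.monotone hj)).trans_le le_self_add
    · exact ((add_lt_add_iff_left _).2 hx).trans (h.lt (j + 1))
  · rintro ⟨n, H⟩
    refine ⟨_, h.lt n, fun x h1 h2 => ?_⟩
    obtain ⟨j, y, hy, rfl⟩ := h.exists_eq h2
    refine H j ?_ y hy
    by_contra hj
    have : partialSum l (j + 1) ≤ partialSum l n := h.strictMono.monotone (by omega)
    exact (((add_lt_add_iff_left _).2 hy).trans_le this).not_gt h1

end IsOmegaSum

/-- `A` has a path of limit length `α` that starts in `q`, whose locations have intersection `V`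
and whose limit set is `L`. -/
def SimpleOrdinalAutomaton.Realizes (A : SimpleOrdinalAutomaton B) (α : Ordinal.{u})
    (q V L : Set B) : Prop :=
  ∃ r : Ordinal.{u} → Set B, Order.IsSuccLimit α ∧ A.PathOn r α ∧ r 0 = q ∧
    alwaysSet r α = V ∧ eventualSet r α = L

namespace SimpleOrdinalAutomaton.Realizes

variable {A : SimpleOrdinalAutomaton B} {α β : Ordinal.{u}} {q q' V V' L L' : Set B}

theorem isSuccLimit (h : A.Realizes α q V L) : Order.IsSuccLimit α := by
  obtain ⟨r, h, -⟩ := h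
  exact h

theorem subset (h : A.Realizes α q V L) : V ⊆ L := by
  obtain ⟨r, h, -, -, rfl, rfl⟩ := h
  exact fun a ha => ⟨0, h.bot_lt, fun x _ hx => ha x hx⟩

theorem append (h1 : A.Realizes α q V L) (h2 : A.Realizes β q' V' L') (hl : (L, q') ∈ A.lim) :
    A.Realizes (α + β) q (V ∩ V') L' := by
  obtain ⟨r1, hα, p1, rfl, rfl, rfl⟩ := h1
  obtain ⟨r2, hβ, p2, rfl, rfl, rfl⟩ := h2
  classical
  let r : Ordinal.{u} → Set B := fun x => if x < α then r1 x else r2 (x - α)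
  have e1 : ∀ x < α, r1 x = r x := fun x hx => (if_pos hx).symm
  have e2 : ∀ x, r2 x = r (α + x) := fun x => by
    simp only [r, if_neg le_self_add.not_gt, Ordinal.add_sub_cancel]
  have e0 : r α = r2 0 := by rw [e2, add_zero]
  refine ⟨r, Ordinal.isSuccLimit_add α hβ, ?_, (e1 0 hα.bot_lt).symm, ?_, ?_⟩
  · refine .append hα (p1.congr e1) (p2.congr fun x _ => e2 x) ?_
    rwa [← eventualSet_congr e1, e0]
  · rw [alwaysSet_add, alwaysSet_congr e1, alwaysSet_congr fun x _ => e2 x]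
  · rw [eventualSet_add r α hβ.bot_lt, eventualSet_congr fun x _ => e2 x]

theorem split (hα : Order.IsSuccLimit α) (hβ : Order.IsSuccLimit β)
    (h : A.Realizes (α + β) q V L) :
    ∃ V₁ L₁ q' V₂, A.Realizes α q V₁ L₁ ∧ (L₁, q') ∈ A.lim ∧ A.Realizes β q' V₂ L ∧
      V = V₁ ∩ V₂ := by
  obtain ⟨r, -, p, rfl, rfl, rfl⟩ := h
  refine ⟨_, _, r α, _, ⟨r, hα, p.mono le_self_add, rfl, rfl, rfl⟩,
    p.lim_mem _ (lt_add_of_pos_right _ hβ.bot_lt) hα,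
    ⟨fun x => r (α + x), hβ, p.tail, by simp, rfl, ?_⟩, alwaysSet_add _ _ _⟩
  rw [eventualSet_add r α hβ.bot_lt]

variable {l : ℕ → Ordinal.{u}} {Q₁ V₁ L₁ : ℕ → Set B}

/-- The limit sets of the blocks serve only to enter the next block; the resulting limit set is
computed from the V's. -/
theorem omega_append (hs : IsOmegaSum l α) (h : ∀ j, A.Realizes (l j) (Q₁ j) (V₁ j) (L₁ j))
    (hl : ∀ j, (L₁ j, Q₁ (j + 1)) ∈ A.lim) :
    A.Realizes α (Q₁ 0) (⋂ j, V₁ j) (eventually V₁) := by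
  choose f hlim p hQ hV hL using h
  obtain ⟨r, hr⟩ := exists_glue hs.strictMono f
  have e : ∀ j, ∀ x < l j, f j x = r (partialSum l j + x) := fun j x hx =>
    (hr j x ((add_lt_add_iff_left _).2 hx)).symm
  have e0 : ∀ j, r (partialSum l j) = Q₁ j := fun j => by
    have := e j 0 (hlim j).bot_lt
    rw [add_zero] at this
    rw [← this, hQ]
  have hP : ∀ j, A.PathOn r (partialSum l (j + 1)) ∧
      eventualSet r (partialSum l (j + 1)) = L₁ j ∧
      Order.IsSuccLimit (partialSum l (j + 1)) := by
    intro j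
    have h2 := (p j).congr (e j)
    have h3 : eventualSet r (partialSum l j + l j) = L₁ j := by
      rw [eventualSet_add r _ (hlim j).bot_lt, ← eventualSet_congr (e j), hL]
    have h4 : Order.IsSuccLimit (partialSum l j + l j) := Ordinal.isSuccLimit_add _ (hlim j)
    refine ⟨?_, h3, h4⟩
    induction j with
    | zero =>
      simp only [partialSum, zero_add] at h2 ⊢
      exact h2
    | succ j ih =>
      have h2' := (p j).congr (e j)
      have h3' : eventualSet r (partialSum l j + l j) = L₁ j := by
        rw [eventualSet_add r _ (hlim j).bot_lt, ← eventualSet_congr (e j), hL]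
      have h4' : Order.IsSuccLimit (partialSum l j + l j) :=
        Ordinal.isSuccLimit_add _ (hlim j)
      refine (ih h2' h3' h4').append h4' h2 ?_
      have h5 := hl j
      rw [← e0, ← h3'] at h5
      exact h5
  refine ⟨r, hs.isSuccLimit, .of_cofinal fun x hx => ?_, e0 0, ?_, ?_⟩
  · obtain ⟨j, hj⟩ := hs.exists_lt x hx
    exact ⟨_, hj.trans (hs.strictMono j.lt_succ_self), (hP j).1⟩
  · rw [hs.alwaysSet_eq]
    exact Set.iInter_congr fun j => by rw [← alwaysSet_congr (e j), hV]
  · rw [hs.eventualSet_eq]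
    congr 1
    funext j
    rw [← alwaysSet_congr (e j), hV]

theorem omega_split (hs : IsOmegaSum l α) (hlim : ∀ j, Order.IsSuccLimit (l j))
    (h : A.Realizes α q V L) :
    ∃ Q₁ V₁ L₁ : ℕ → Set B, (∀ j, A.Realizes (l j) (Q₁ j) (V₁ j) (L₁ j)) ∧
      (∀ j, (L₁ j, Q₁ (j + 1)) ∈ A.lim) ∧ Q₁ 0 = q ∧ V = ⋂ j, V₁ j ∧ L = eventually V₁ := by
  obtain ⟨r, -, p, rfl, rfl, rfl⟩ := h
  refine ⟨fun j => r (partialSum l j), fun j => alwaysSet (fun x => r (partialSum l j + x)) (l j),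
    fun j => eventualSet (fun x => r (partialSum l j + x)) (l j), fun j => ?_, fun j => ?_, rfl,
    hs.alwaysSet_eq r, hs.eventualSet_eq r⟩
  · refine ⟨_, hlim j, ?_, by simp, rfl, rfl⟩
    exact (p.mono (hs.lt (j + 1)).le).tail
  · have := p.lim_mem (partialSum l (j + 1)) (hs.lt _) (Ordinal.isSuccLimit_add _ (hlim j))
    rw [partialSum, eventualSet_add r _ (hlim j).bot_lt] at this
    exact this

/-- Concatenation of the first blocks of a sequence. -/
theorem partial_append (h : ∀ j, A.Realizes (l j) (Q₁ j) (V₁ j) (L₁ j))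
    (hl : ∀ j, (L₁ j, Q₁ (j + 1)) ∈ A.lim) (j : ℕ) :
    A.Realizes (partialSum l (j + 1)) (Q₁ 0) {a | ∀ i ≤ j, a ∈ V₁ i} (L₁ j) := by
  induction j with
  | zero => simpa [partialSum] using h 0
  | succ j ih =>
    have e : {a | ∀ i ≤ j + 1, a ∈ V₁ i} = {a | ∀ i ≤ j, a ∈ V₁ i} ∩ V₁ (j + 1) := by
      ext a
      refine ⟨fun H => ⟨fun i hi => H i (by omega), H _ le_rfl⟩, fun H i hi => ?_⟩
      rcases Nat.lt_or_ge i (j + 1) with h | h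
      · exact H.1 i (by omega)
      · rw [show i = j + 1 by omega]; exact H.2
    rw [e]
    exact ih.append (h (j + 1)) (hl j)

end SimpleOrdinalAutomaton.Realizes

end Types

/-! ### Absorption and ω-sums for powers of ω. -/

section OmegaPowers

theorem isSuccLimit_omega0_pow (k : ℕ) : Order.IsSuccLimit ((ω : Ordinal.{u}) ^ (k + 1)) := by
  have := Ordinal.isSuccLimit_opow_left (b := ((k + 1 : ℕ) : Ordinal.{u})) isSuccLimit_omega0
    (by exact_mod_cast k.succ_ne_zero)
  rwa [opow_natCast] at this

theorem omega0_pow_pos (k : ℕ) : 0 < (ω : Ordinal.{u}) ^ k := by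
  rw [← opow_natCast]
  exact opow_pos _ omega0_pos

theorem add_lt_omega0_pow {k : ℕ} {a b : Ordinal.{u}} (ha : a < ω ^ k) (hb : b < ω ^ k) :
    a + b < ω ^ k := by
  rw [← opow_natCast] at *
  exact isPrincipal_add_omega0_opow _ ha hb

theorem add_omega0_pow_mul {k : ℕ} {a γ : Ordinal.{u}} (ha : a < ω ^ k) (hγ : 0 < γ) :
    a + ω ^ k * γ = ω ^ k * γ := by
  have h1 : (1 : Ordinal.{u}) ≤ γ := Order.one_le_iff_pos.2 hγ
  have h2 : a + ω ^ k = ω ^ k := by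
    rw [← opow_natCast] at *
    exact add_omega0_opow ha
  rw [← Ordinal.add_sub_cancel_of_le h1, mul_add, mul_one, ← add_assoc, h2]

theorem add_omega0_pow {k : ℕ} {a : Ordinal.{u}} (ha : a < ω ^ k) : a + ω ^ k = ω ^ k := by
  simpa using add_omega0_pow_mul ha one_pos

theorem omega0_pow_mul_natCast_lt (k n : ℕ) : (ω : Ordinal.{u}) ^ k * n < ω ^ (k + 1) := by
  rw [pow_succ]
  exact mul_lt_mul_of_pos_left (natCast_lt_omega0 n) (omega0_pow_pos k)

theorem IsOmegaSum.mul_left {g : ℕ → Ordinal.{u}} {γ a : Ordinal.{u}} (ha : 0 < a)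
    (h : IsOmegaSum g γ) : IsOmegaSum (fun j => a * g j) (a * γ) := by
  have e : ∀ j, partialSum (fun j => a * g j) j = a * partialSum g j := by
    intro j
    induction j with
    | zero => simp [partialSum]
    | succ j ih => simp only [partialSum, ih, mul_add]
  refine ⟨fun j => mul_pos ha (h.pos j), fun j => ?_, fun x hx => ?_⟩
  · rw [e]; exact mul_lt_mul_of_pos_left (h.lt j) ha
  · obtain ⟨j, hj⟩ := h.exists_lt _ ((Ordinal.lt_mul_iff_div_lt ha.ne').1 hx)
    exact ⟨j, by rw [e]; exact (Ordinal.lt_mul_iff_div_lt ha.ne').2 hj⟩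

theorem partialSum_const (a : Ordinal.{u}) (j : ℕ) : partialSum (fun _ => a) j = a * j := by
  induction j with
  | zero => simp [partialSum]
  | succ j ih => simp only [partialSum, ih, Nat.cast_succ, mul_add, mul_one]

theorem partialSum_le {l l' : ℕ → Ordinal.{u}} (h : ∀ j, l j ≤ l' j) (j : ℕ) :
    partialSum l j ≤ partialSum l' j := by
  induction j with
  | zero => exact le_rfl
  | succ j ih => exact add_le_add ih (h j)

/-- A sum of `ω` many ordinals between `ω ^ k` and `ω ^ (k + 1)`. -/
theorem isOmegaSum_pow {k : ℕ} {l : ℕ → Ordinal.{u}} (h1 : ∀ j, ω ^ k ≤ l j)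
    (h2 : ∀ j, l j < ω ^ (k + 1)) : IsOmegaSum l (ω ^ (k + 1)) := by
  refine ⟨fun j => (omega0_pow_pos k).trans_le (h1 j), fun j => ?_, fun x hx => ?_⟩
  -- The upper bound on the terms keeps the partial sums below ω^(k+1), which is additively
  -- principal; the lower bound makes them cofinal.
  · induction j with
    | zero => exact omega0_pow_pos _
    | succ j ih => exact add_lt_omega0_pow ih (h2 j)
  · rw [pow_succ, Ordinal.lt_mul_iff_div_lt (omega0_pow_pos k).ne', lt_omega0] at hx
    obtain ⟨n, hn⟩ := hx
    refine ⟨n + 1, lt_of_lt_of_le ?_ (partialSum_le h1 _)⟩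
    rw [partialSum_const, Ordinal.lt_mul_iff_div_lt (omega0_pow_pos k).ne', hn]
    exact_mod_cast n.lt_succ_self

theorem isOmegaSum_const_pow (k : ℕ) :
    IsOmegaSum (fun _ => (ω : Ordinal.{u}) ^ k) (ω ^ (k + 1)) :=
  isOmegaSum_pow (fun _ => le_rfl) fun _ => by
    simpa using omega0_pow_mul_natCast_lt.{u} k 1

/-- Differences of a cofinal ω-sequence telescope. All uses of countability go through this
decomposition. -/
theorem exists_isOmegaSum_eq {γ : Ordinal.{u}} (hγ : Order.IsSuccLimit γ) (hc : γ.card ≤ ℵ₀) :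
    ∃ g : ℕ → Ordinal.{u}, IsOmegaSum g γ := by
  obtain ⟨s, h0, hs, hlt, hex⟩ := Ordinal.exists_cofinal_seq hγ hc
  have e : ∀ j, partialSum (fun j => s (j + 1) - s j) j = s j := by
    intro j
    induction j with
    | zero => exact h0.symm
    | succ j ih =>
      rw [partialSum, ih, Ordinal.add_sub_cancel_of_le (hs j.lt_succ_self).le]
  refine ⟨fun j => s (j + 1) - s j, fun j => ?_, fun j => ?_, fun x hx => ?_⟩
  · simpa [Ordinal.lt_sub] using hs j.lt_succ_self
  · rw [e]; exact hlt j
  · obtain ⟨j, hj⟩ := hex x hx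
    exact ⟨j, by rwa [e]⟩

theorem IsOmegaSum.term_lt {g : ℕ → Ordinal.{u}} {γ : Ordinal.{u}} (h : IsOmegaSum g γ) (j : ℕ) :
    g j < γ :=
  lt_of_le_of_lt le_add_self (h.lt (j + 1))

end OmegaPowers

/-! ### Shortening and lengthening paths with a fixed summary. -/

section Pumping

variable {B : Type v} [Finite B]

omit [Finite B] in
theorem eventually_shift (V : ℕ → Set B) (n : ℕ) :
    eventually (fun j => V (n + j)) = eventually V := by
  ext a
  constructor
  · rintro ⟨m, hm⟩
    refine ⟨n + m, fun j hj => ?_⟩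
    have : a ∈ V (n + (j - n)) := hm (j - n) (by omega)
    rwa [show n + (j - n) = j by omega] at this
  · rintro ⟨m, hm⟩
    exact ⟨m, fun j hj => hm _ (by omega)⟩

/-- Each element has its own threshold; finiteness of the basis gives a common one. -/
theorem exists_eventually_subset (V : ℕ → Set B) : ∃ n, ∀ j, n ≤ j → eventually V ⊆ V j := by
  classical
  have : ∀ a : B, ∃ n, a ∈ eventually V → ∀ j, n ≤ j → a ∈ V j := by
    intro a
    by_cases h : a ∈ eventually V
    · obtain ⟨n, hn⟩ := h
      exact ⟨n, fun _ => hn⟩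
    · exact ⟨0, fun h' => (h h').elim⟩
  choose f hf using this
  obtain ⟨n, hn⟩ := (Set.finite_range f).bddAbove
  exact ⟨n, fun j hj a ha => hf a ha j ((hn ⟨a, rfl⟩).trans hj)⟩

namespace SimpleOrdinalAutomaton.Realizes

variable {A : SimpleOrdinalAutomaton B} {α : Ordinal.{u}} {q V L : Set B}

/-- A path of length `ω ^ (k + 2)` has a final segment all whose locations contain its
limit set. -/
theorem exists_pure_tail {k : ℕ} (h : A.Realizes (omega0.{u} ^ (k + 2)) q V L) :
    ∃ (N : ℕ) (V₁ L₁ q' : Set B), A.Realizes (omega0.{u} ^ (k + 1) * (N + 1 : ℕ)) q V₁ L₁ ∧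
      (L₁, q') ∈ A.lim ∧ A.Realizes (omega0.{u} ^ (k + 2)) q' L L ∧ V = V₁ ∩ L := by
  have hs := isOmegaSum_const_pow.{u} (k + 1)
  obtain ⟨Q', V', L', hb, hl, rfl, rfl, rfl⟩ :=
    h.omega_split hs fun _ => isSuccLimit_omega0_pow k
  obtain ⟨n, hn⟩ := exists_eventually_subset V'
  -- Blocks 0 to n are split off, so the initial part has positive length and the remaining blocks
  -- lie beyond the threshold.
  have hp := partial_append hb hl n
  have ht := omega_append hs (Q₁ := fun j => Q' (n + 1 + j)) (V₁ := fun j => V' (n + 1 + j))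
    (L₁ := fun j => L' (n + 1 + j)) (fun j => hb _) fun j => hl _
  have e : (⋂ j, V' (n + 1 + j)) = eventually V' := by
    apply subset_antisymm
    · refine fun a ha => ⟨n + 1, fun j hj => ?_⟩
      have := Set.mem_iInter.1 ha (j - (n + 1))
      rwa [show n + 1 + (j - (n + 1)) = j by omega] at this
    · exact Set.subset_iInter fun j => hn _ (by omega)
  rw [e, eventually_shift] at ht
  rw [partialSum_const] at hp
  refine ⟨n, _, _, _, hp, hl n, ht, ?_⟩
  rw [← e]
  ext a
  simp only [Set.mem_iInter, Set.mem_inter_iff, Set.mem_ofPred_eq]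
  refine ⟨fun H => ⟨fun i _ => H i, fun j => H _⟩, fun H i => ?_⟩
  rcases Nat.lt_or_ge n i with h | h
  · have := H.2 (i - (n + 1))
    rwa [show n + 1 + (i - (n + 1)) = i by omega] at this
  · exact H.1 i h

omit [Finite B] in
/-- If all locations of a path of length `ω ^ (k + 2)` contain its limit set `L`, then `L` is
already the limit set at some earlier multiple of `ω ^ (k + 1)`, or the limit sets at all
multiples of `ω ^ (k + 1)` are larger. -/
theorem pure_cases {k : ℕ} (h : A.Realizes (omega0.{u} ^ (k + 2)) q L L) :
    (∃ (N : ℕ) (q' : Set B), A.Realizes (omega0.{u} ^ (k + 1) * (N + 1 : ℕ)) q L L ∧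
      (L, q') ∈ A.lim ∧ A.Realizes (omega0.{u} ^ (k + 2)) q' L L) ∨
    ∃ Q' V' L' : ℕ → Set B, (∀ j, A.Realizes (omega0.{u} ^ (k + 1)) (Q' j) (V' j) (L' j)) ∧
      (∀ j, (L' j, Q' (j + 1)) ∈ A.lim) ∧ Q' 0 = q ∧ L = ⋂ j, V' j ∧ L = eventually V' ∧
      ∀ j, L ⊂ L' j := by
  have hs := isOmegaSum_const_pow.{u} (k + 1)
  obtain ⟨Q', V', L', hb, hl, hq, hV, hL⟩ :=
    h.omega_split hs fun _ => isSuccLimit_omega0_pow k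
  have hsub : ∀ j, L ⊆ V' j := fun j => hV ▸ Set.iInter_subset _ j
  by_cases hc : ∃ j, L' j = L
  · left
    obtain ⟨n, hn⟩ := hc
    have hp := partial_append hb hl n
    have ht := omega_append hs (Q₁ := fun j => Q' (n + 1 + j)) (V₁ := fun j => V' (n + 1 + j))
      (L₁ := fun j => L' (n + 1 + j)) (fun j => hb _) fun j => hl _
    have hmem := hl n
    rw [eventually_shift, ← hL] at ht
    rw [partialSum_const, hq, hn] at hp
    -- The last block gives one inclusion: its intersection is contained in its limit set, which is
    -- L.
    have e1 : {a | ∀ i ≤ n, a ∈ V' i} = L :=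
      subset_antisymm (fun a ha => hn ▸ (hb n).subset (ha n le_rfl)) fun a ha i _ => hsub i ha
    have e2 : (⋂ j, V' (n + 1 + j)) = L :=
      subset_antisymm ht.subset (Set.subset_iInter fun j => hsub _)
    rw [e1] at hp
    rw [e2] at ht
    rw [hn] at hmem
    exact ⟨n, _, hp, hmem, ht⟩
  · right
    push Not at hc
    exact ⟨Q', V', L', hb, hl, hq, hV, hL, fun j =>
      ((hsub j).trans (hb j).subset).ssubset_of_ne (hc j).symm⟩

/-- The decreasing measure of the pumping inductions. -/
theorem ncard_compl_lt {L L' : Set B} (h : L ⊂ L') : L'ᶜ.ncard < Lᶜ.ncard :=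
  Set.ncard_lt_ncard (compl_lt_compl_iff_lt.2 h) (Set.toFinite _)

/-- Contraction of a path of length `ω ^ (k + 1)`. -/
theorem exists_shorter {k : ℕ} (h : A.Realizes (omega0.{u} ^ (k + 1)) q V L) (hk : Lᶜ.ncard + 1 ≤ k) :
    ∃ l, omega0.{u} ^ k ≤ l ∧ l < omega0.{u} ^ (k + 1) ∧ A.Realizes l q V L := by
  induction k generalizing q V L with
  | zero => omega
  | succ k ih =>
    obtain ⟨N, V₁, L₁, q', hp, hm, ht, rfl⟩ := h.exists_pure_tail
    have hN : (omega0.{u} : Ordinal.{u}) ^ (k + 1) ≤ omega0.{u} ^ (k + 1) * (N + 1 : ℕ) :=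
      Ordinal.le_mul_left _ (by exact_mod_cast N.succ_pos)
    have hN' := omega0_pow_mul_natCast_lt.{u} (k + 1) (N + 1)
    rcases ht.pure_cases with ⟨n, q'', h1, -, -⟩ | ⟨Q', V', L', hb, hl, hq, hV, hL, hss⟩
    -- The path stops where L is first known to recur as a limit set; the remaining ω^(k+2)
    -- positions are dropped.
    · exact ⟨_, hN.trans le_self_add,
        add_lt_omega0_pow hN' (omega0_pow_mul_natCast_lt (k + 1) (n + 1)), hp.append h1 hm⟩
    -- Every block has a larger limit set, hence can be shortened. The lower bound ω^k makes the
    -- shortened blocks add up to exactly ω^(k+1).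
    · have hc : ∀ j, ∃ l, omega0.{u} ^ k ≤ l ∧ l < omega0.{u} ^ (k + 1) ∧ A.Realizes l (Q' j) (V' j) (L' j) :=
        fun j => ih (hb j) (by have := ncard_compl_lt (hss j); omega)
      choose l hl1 hl2 hl3 using hc
      have hr := omega_append (isOmegaSum_pow hl1 hl2) hl3 hl
      rw [← hV, ← hL, hq] at hr
      refine ⟨_, hN.trans le_self_add, add_lt_omega0_pow hN' ?_, hp.append hr hm⟩
      simpa using omega0_pow_mul_natCast_lt.{u} (k + 1) 1

/-- Once the first summand is contracted to ω^(k+1), `exists_shorter` brings it below ω^(k+1), where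
the second summand absorbs it. -/
theorem contract_add {k : ℕ} (hk : Nat.card B + 1 ≤ k) (hα : Order.IsSuccLimit α)
    (hc : ∀ {q V L}, A.Realizes α q V L → A.Realizes (omega0.{u} ^ (k + 1)) q V L)
    (h : A.Realizes (α + omega0.{u} ^ (k + 1)) q V L) : A.Realizes (omega0.{u} ^ (k + 1)) q V L := by
  obtain ⟨V₁, L₁, q', V₂, h1, hm, h2, rfl⟩ := h.split hα (isSuccLimit_omega0_pow k)
  obtain ⟨l, -, hl, h3⟩ := (hc h1).exists_shorter ((Nat.succ_le_succ (Set.ncard_le_card _)).trans hk)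
  simpa only [add_omega0_pow hl] using h3.append h2 hm

theorem contract_mul_natCast {k : ℕ} (hk : Nat.card B + 1 ≤ k) (n : ℕ)
    (h : A.Realizes (omega0.{u} ^ (k + 1) * (n + 1 : ℕ)) q V L) : A.Realizes (omega0.{u} ^ (k + 1)) q V L := by
  induction n generalizing q V L with
  | zero => simpa using h
  | succ n ih =>
    rw [Nat.cast_succ, mul_add, mul_one] at h
    exact contract_add hk (Ordinal.isSuccLimit_mul_left (isSuccLimit_omega0_pow k)
      (by exact_mod_cast n.succ_pos)) ih h

/-- As `k` exceeds the size of the basis, blocks of length ω^(k+1) can be shortened whatever their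
limit sets, and the shortened blocks sum to ω^(k+1). -/
theorem contract_pow_succ {k : ℕ} (hk : Nat.card B + 1 ≤ k) (h : A.Realizes (omega0.{u} ^ (k + 2)) q V L) :
    A.Realizes (omega0.{u} ^ (k + 1)) q V L := by
  have hk' : ∀ L : Set B, Lᶜ.ncard + 1 ≤ k := fun L =>
    (Nat.succ_le_succ (Set.ncard_le_card _)).trans hk
  obtain ⟨N, V₁, L₁, q', hp, hm, ht, rfl⟩ := h.exists_pure_tail
  have ht' : A.Realizes (omega0.{u} ^ (k + 1)) q' L L := by
    rcases ht.pure_cases with ⟨n, q'', h1, -, -⟩ | ⟨Q', V', L', hb, hl, hq, hV, hL, -⟩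
    · exact contract_mul_natCast hk n h1
    · choose l hl1 hl2 hl3 using fun j => (hb j).exists_shorter (hk' _)
      have hr := omega_append (isOmegaSum_pow hl1 hl2) hl3 hl
      rwa [← hV, ← hL, hq] at hr
  obtain ⟨l, -, hl, h3⟩ := (contract_mul_natCast hk N hp).exists_shorter (hk' _)
  simpa only [add_omega0_pow hl] using h3.append ht' hm

theorem contract {k : ℕ} (hk : Nat.card B + 1 ≤ k) {γ : Ordinal.{u}} (hγ : 0 < γ)
    (hc : γ.card ≤ ℵ₀) (h : A.Realizes (omega0.{u} ^ (k + 1) * γ) q V L) :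
    A.Realizes (omega0.{u} ^ (k + 1)) q V L := by
  induction γ using WellFoundedLT.induction generalizing q V L with
  | ind γ ih =>
    rcases Ordinal.zero_or_succ_or_isSuccLimit γ with rfl | ⟨γ, rfl⟩ | hlim
    · exact hγ.false.elim
    · rcases (zero_le (a := γ)).eq_or_lt with rfl | h0
      · simpa using h
      · rw [Order.succ_eq_add_one, mul_add, mul_one] at h
        have hlt := Order.lt_succ γ
        exact contract_add hk (Ordinal.isSuccLimit_mul_left (isSuccLimit_omega0_pow k) h0)
          (ih γ hlt h0 ((Ordinal.card_le_card hlt.le).trans hc)) h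
    · obtain ⟨g, hg⟩ := exists_isOmegaSum_eq hlim hc
      obtain ⟨Q', V', L', hb, hl, rfl, rfl, rfl⟩ :=
        h.omega_split (hg.mul_left (omega0_pow_pos (k + 1))) fun j =>
          Ordinal.isSuccLimit_mul_left (isSuccLimit_omega0_pow k) (hg.pos j)
      -- Contracting each block to ω^(k+1) leaves a path of length ω^(k+2).
      exact contract_pow_succ hk (omega_append (isOmegaSum_const_pow (k + 1)) (fun j =>
        ih _ (hg.term_lt j) (hg.pos j) ((Ordinal.card_le_card (hg.term_lt j).le).trans hc) (hb j))
        hl)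

omit [Finite B] in
-- The summary (q, L, L) is idempotent under concatenation and ω-concatenation, so transfinite
-- repetition preserves it.
theorem loop (h : A.Realizes α q L L) (hl : (L, q) ∈ A.lim) {γ : Ordinal.{u}} (hγ : 0 < γ)
    (hc : γ.card ≤ ℵ₀) : A.Realizes (α * γ) q L L := by
  induction γ using WellFoundedLT.induction with
  | ind γ ih =>
    rcases Ordinal.zero_or_succ_or_isSuccLimit γ with rfl | ⟨γ, rfl⟩ | hlim
    · exact hγ.false.elim
    · rcases (zero_le (a := γ)).eq_or_lt with rfl | h0
      · simpa using h
      · have hlt := Order.lt_succ γ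
        rw [Order.succ_eq_add_one, mul_add, mul_one]
        simpa using (ih γ hlt h0 ((Ordinal.card_le_card hlt.le).trans hc)).append h hl
    · obtain ⟨g, hg⟩ := exists_isOmegaSum_eq hlim hc
      have := omega_append (hg.mul_left h.isSuccLimit.bot_lt) (fun j =>
        ih _ (hg.term_lt j) (hg.pos j) ((Ordinal.card_le_card (hg.term_lt j).le).trans hc))
        fun _ => hl
      have e : eventually (fun _ : ℕ => L) = L := by
        ext a
        exact ⟨fun ⟨n, hn⟩ => hn n le_rfl, fun ha => ⟨0, fun _ _ => ha⟩⟩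
      rwa [Set.iInter_const, e] at this

theorem expand {k : ℕ} (h : A.Realizes (omega0.{u} ^ (k + 1)) q V L) (hk : Lᶜ.ncard + 1 ≤ k)
    {γ : Ordinal.{u}} (hγ : 0 < γ) (hc : γ.card ≤ ℵ₀) : A.Realizes (omega0.{u} ^ (k + 1) * γ) q V L := by
  induction k generalizing q V L γ with
  | zero => omega
  | succ k ih =>
    obtain ⟨N, V₁, L₁, q', hp, hm, ht, rfl⟩ := h.exists_pure_tail
    have hN := omega0_pow_mul_natCast_lt.{u} (k + 1) (N + 1)
    suffices H : A.Realizes (omega0.{u} ^ (k + 2) * γ) q' L L by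
      have := hp.append H hm
      rwa [add_omega0_pow_mul hN hγ] at this
    rcases ht.pure_cases with ⟨n, q'', h1, hm', h2⟩ | ⟨Q', V', L', hb, hl, hq, hV, hL, hss⟩
    · have := h1.append (h2.loop hm' hγ hc) hm'
      rwa [add_omega0_pow_mul (omega0_pow_mul_natCast_lt (k + 1) (n + 1)) hγ,
        Set.inter_self] at this
    -- Since ω^(k+2) * γ = ω^(k+1) * (ω * γ) and ω * γ is a limit, the extra length can be
    -- distributed over the ω many blocks.
    · have hlim : Order.IsSuccLimit (omega0.{u} * γ) := Ordinal.isSuccLimit_mul_left isSuccLimit_omega0 hγ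
      have hc' : (omega0.{u} * γ).card ≤ ℵ₀ := by
        rw [Ordinal.card_mul, Ordinal.card_omega0]
        exact (mul_le_mul' le_rfl hc).trans aleph0_mul_aleph0.le
      obtain ⟨g, hg⟩ := exists_isOmegaSum_eq hlim hc'
      have := omega_append (hg.mul_left (omega0_pow_pos (k + 1))) (fun j =>
        ih (hb j) (by have := ncard_compl_lt (hss j); omega) (hg.pos j)
          ((Ordinal.card_le_card (hg.term_lt j).le).trans hc')) hl
      rwa [← hV, ← hL, hq, ← mul_assoc, ← pow_succ] at this

end SimpleOrdinalAutomaton.Realizes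

end Pumping

/-! ### From summaries to accepting runs. -/

section Runs

variable {B : Type v}

theorem limitSet_eq_eventualSet {α β : Ordinal.{u}} (r : Ordinal.{u} → Set B) (hβ : β ≤ α) :
    limitSet (fun x : Set.Iio α => r x.1) β = eventualSet r β := by
  ext a
  constructor
  · rintro ⟨γ, hγ, H⟩
    exact ⟨γ.1, hγ, fun x h1 h2 => H ⟨x, h2.trans_le hβ⟩ h1 h2⟩
  · rintro ⟨γ, hγ, H⟩
    exact ⟨⟨γ, hγ.trans_le hβ⟩, hγ, fun x h1 h2 => H x.1 h1 h2⟩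

theorem exists_extend {X : Type*} [Inhabited X] {α : Ordinal.{u}} (f : Set.Iio α → X) :
    ∃ r : Ordinal.{u} → X, (fun x : Set.Iio α => r x.1) = f := by
  classical
  refine ⟨fun x => if h : x < α then f ⟨x, h⟩ else default, ?_⟩
  funext x
  exact dif_pos x.2

/-- A path of length `δ` that follows the limit set `L` and satisfies the acceptance conditions
at its end. -/
def AcceptingOrdinalAutomaton.AcceptsRest (A : AcceptingOrdinalAutomaton B) (L : Set B)
    (δ : Ordinal.{u}) : Prop :=
  (δ = 0 ∧ L ∈ A.limF) ∨
    (0 < δ ∧ ∃ r : Ordinal.{u} → Set B, A.PathOn r δ ∧ (L, r 0) ∈ A.lim ∧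
      (∀ β, δ = β + 1 → r β ∈ A.F) ∧ (Order.IsSuccLimit δ → eventualSet r δ ∈ A.limF))

namespace AcceptingOrdinalAutomaton

variable {A : AcceptingOrdinalAutomaton B} {α δ : Ordinal.{u}}

theorem hasAcceptingRun_iff : A.HasAcceptingRun α ↔
    ∃ r : Ordinal.{u} → Set B, 0 < α ∧ A.PathOn r α ∧ r 0 ∈ A.I ∧
      (∀ β, α = β + 1 → r β ∈ A.F) ∧ (Order.IsSuccLimit α → eventualSet r α ∈ A.limF) := by
  constructor
  · rintro ⟨f, hf⟩
    obtain ⟨r, rfl⟩ := exists_extend f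
    refine ⟨r, hf.pos, ⟨fun β hβ => hf.mem_Q ⟨β, hβ⟩, fun β hβ =>
      hf.next_mem ⟨β, lt_of_le_of_lt le_self_add hβ⟩ ⟨_, hβ⟩ rfl, fun β hβ hl => ?_⟩, hf.initial,
      fun β hβ => hf.final ⟨β, hβ ▸ lt_add_one β⟩ hβ, fun hl => ?_⟩
    · rw [← limitSet_eq_eventualSet r hβ.le]
      exact hf.lim_mem ⟨β, hβ⟩ hl
    · rw [← limitSet_eq_eventualSet r le_rfl]
      exact hf.limit hl
  · rintro ⟨r, h0, hp, hI, hF, hL⟩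
    refine ⟨fun x => r x.1, ⟨⟨h0, fun β => hp.mem_Q _ β.2, fun β γ h => ?_, fun β hl => ?_⟩, hI,
      fun β => hF _, fun hl => ?_⟩⟩
    · rw [h]
      exact hp.next_mem _ (h ▸ γ.2)
    · rw [limitSet_eq_eventualSet r β.2.le]
      exact hp.lim_mem _ β.2 hl
    · rw [limitSet_eq_eventualSet r le_rfl]
      exact hL hl

/-- Separates the pumpable part from the remainder `δ`: the two communicate only through the limit
set L. -/
theorem hasAcceptingRun_add_iff (hα : Order.IsSuccLimit α) : A.HasAcceptingRun (α + δ) ↔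
    ∃ q V L, A.Realizes α q V L ∧ q ∈ A.I ∧ A.AcceptsRest L δ := by
  rw [hasAcceptingRun_iff]
  constructor
  · rintro ⟨r, -, hp, hI, hF, hL⟩
    refine ⟨_, _, _, ⟨r, hα, hp.mono le_self_add, rfl, rfl, rfl⟩, hI, ?_⟩
    rcases (zero_le (a := δ)).eq_or_lt with rfl | h0
    · rw [add_zero] at hL
      exact .inl ⟨rfl, hL hα⟩
    · refine .inr ⟨h0, fun x => r (α + x), hp.tail, ?_, fun β hβ => ?_, fun hl => ?_⟩
      · simpa using hp.lim_mem α (lt_add_of_pos_right _ h0) hα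
      · exact hF _ (by rw [hβ, add_assoc])
      · rw [← eventualSet_add r α h0]
        exact hL (Ordinal.isSuccLimit_add _ hl)
  · rintro ⟨_, _, _, ⟨r, -, hp, rfl, rfl, rfl⟩, hI, ⟨rfl, hL⟩ | ⟨h0, r', hp', hm, hF, hL⟩⟩
    · rw [add_zero]
      refine ⟨r, hα.bot_lt, hp, hI, fun β hβ => ?_, fun _ => hL⟩
      rw [hβ] at hα
      exact (Order.not_isSuccLimit_add_one β hα).elim
    · classical
      let f : Ordinal.{u} → Set B := fun x => if x < α then r x else r' (x - α)
      have e1 : ∀ x < α, r x = f x := fun x hx => (if_pos hx).symm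
      have e2 : ∀ x, r' x = f (α + x) := fun x => by
        simp only [f, if_neg le_self_add.not_gt, Ordinal.add_sub_cancel]
      have e0 : f α = r' 0 := by rw [e2, add_zero]
      refine ⟨f, hα.bot_lt.trans_le le_self_add,
        .append hα (hp.congr e1) (hp'.congr fun x _ => e2 x) ?_, ?_, fun β hβ => ?_, fun hl => ?_⟩
      · rwa [← eventualSet_congr e1, e0]
      · rwa [← e1 0 hα.bot_lt]
      · have hle : α ≤ β := by
          rw [← Order.lt_add_one_iff, ← hβ]
          exact lt_add_of_pos_right _ h0
        rw [← Ordinal.add_sub_cancel_of_le hle, add_assoc, add_left_cancel_iff] at hβ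
        rw [← Ordinal.add_sub_cancel_of_le hle, ← e2]
        exact hF _ hβ
      · rw [eventualSet_add f α h0, ← eventualSet_congr fun x _ => e2 x]
        exact hL (((Ordinal.isSuccLimit_add_iff).1 hl).resolve_right fun h => h0.ne' h.1)

/-- Acceptance of `ω ^ n * γ + δ` does not depend on the nonzero countable ordinal `γ`, if `n` is
large enough. -/
theorem hasAcceptingRun_mul_add_iff [Finite B] {γ : Ordinal.{u}} (hγ : 0 < γ) (hc : γ.card ≤ ℵ₀) :
    A.HasAcceptingRun (ω ^ (Nat.card B + 2) * γ + δ) ↔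
      A.HasAcceptingRun (ω ^ (Nat.card B + 2) + δ) := by
  have hl := isSuccLimit_omega0_pow.{u} (Nat.card B + 1)
  rw [hasAcceptingRun_add_iff (Ordinal.isSuccLimit_mul_left hl hγ), hasAcceptingRun_add_iff hl]
  constructor
  · rintro ⟨q, V, L, h, H⟩
    exact ⟨q, V, L, h.contract le_rfl hγ hc, H⟩
  · rintro ⟨q, V, L, h, H⟩
    exact ⟨q, V, L, h.expand (Nat.succ_le_succ (Set.ncard_le_card _)) hγ hc, H⟩

end AcceptingOrdinalAutomaton

/-- Equivalent ordinals are equal or have the same remainder modulo `ω ^ n` and nonzero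
quotients. -/
theorem OrdEquiv.eq_or {n : ℕ} {α β : Ordinal.{u}} (h : OrdEquiv n α β) :
    α = β ∨ (0 < α / ω ^ n ∧ 0 < β / ω ^ n ∧ α % ω ^ n = β % ω ^ n) := by
  have hn := omega0_pow_pos.{u} n
  have hα := Ordinal.mod_lt α hn.ne'
  have hβ := Ordinal.mod_lt β hn.ne'
  have eα := Ordinal.div_add_mod α (ω ^ n)
  have eβ := Ordinal.div_add_mod β (ω ^ n)
  rw [OrdEquiv, ordTruncation, ordTruncation] at h
  have hmin : ∀ {x : Ordinal.{u}}, 0 < x → min x 1 = 1 := fun hx =>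
    min_eq_right (Order.one_le_iff_pos.2 hx)
  rcases (zero_le (a := α / ω ^ n)).eq_or_lt with h1 | h1 <;>
    rcases (zero_le (a := β / ω ^ n)).eq_or_lt with h2 | h2
  · left
    rw [← h1] at eα h
    rw [← h2] at eβ h
    rw [← eα, ← eβ]
    simpa using h
  · rw [← h1, hmin h2] at h
    simp only [zero_le, inf_of_le_left, mul_zero, zero_add, mul_one] at h
    exact (hα.not_ge (h ▸ le_self_add)).elim
  · rw [← h2, hmin h1] at h
    simp only [zero_le, inf_of_le_left, mul_zero, zero_add, mul_one] at h
    exact (hβ.not_ge (h ▸ le_self_add)).elim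
  · rw [hmin h1, hmin h2] at h
    exact .inr ⟨h1, h2, add_left_cancel h⟩

theorem AcceptingOrdinalAutomaton.hasAcceptingRun_congr [Finite B]
    (A : AcceptingOrdinalAutomaton B) {α β : Ordinal.{u}} (hα : α.card ≤ ℵ₀) (hβ : β.card ≤ ℵ₀)
    (h : OrdEquiv (Nat.card B + 2) α β) : A.HasAcceptingRun α ↔ A.HasAcceptingRun β := by
  have hdiv : ∀ x : Ordinal.{u}, x / ω ^ (Nat.card B + 2) ≤ x := fun x =>
    Ordinal.div_le_of_le_mul (Ordinal.le_mul_right _ (omega0_pow_pos _))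
  rcases h.eq_or with rfl | ⟨h1, h2, h3⟩
  · rfl
  · rw [← Ordinal.div_add_mod α (ω ^ (Nat.card B + 2)),
      ← Ordinal.div_add_mod β (ω ^ (Nat.card B + 2)), h3,
      hasAcceptingRun_mul_add_iff h1 ((Ordinal.card_le_card (hdiv α)).trans hα),
      hasAcceptingRun_mul_add_iff h2 ((Ordinal.card_le_card (hdiv β)).trans hβ)]

end Runs

/-! ### Local characterisations of strict until and since. -/

section TemporalOperators

/-- `p` holds at all large enough ordinals below `β`. -/
def HoldsEventually (p : Ordinal.{u} → Prop) (β : Ordinal.{u}) : Prop :=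
  ∃ γ < β, ∀ x, γ < x → x < β → p x

/-- Strict "until" on the ordinals below `α`. -/
def UntilBelow (α : Ordinal.{u}) (p q : Ordinal.{u} → Prop) (β : Ordinal.{u}) : Prop :=
  ∃ γ, β < γ ∧ γ < α ∧ q γ ∧ ∀ x, β < x → x < γ → p x

/-- Strict "since". -/
def SinceBelow (p q : Ordinal.{u} → Prop) (β : Ordinal.{u}) : Prop :=
  ∃ γ < β, q γ ∧ ∀ x, γ < x → x < β → p x

/-- The local conditions that determine strict "until" on the ordinals below `α`. -/
structure IsUntil (α : Ordinal.{u}) (p q t : Ordinal.{u} → Prop) : Prop where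
  succ : ∀ β, β + 1 < α → (t β ↔ q (β + 1) ∨ p (β + 1) ∧ t (β + 1))
  lim_right : ∀ β < α, Order.IsSuccLimit β → HoldsEventually (fun x => ¬ q x) β →
    HoldsEventually p β → HoldsEventually t β → q β ∨ p β ∧ t β
  lim_left : ∀ β < α, Order.IsSuccLimit β → HoldsEventually p β → q β ∨ p β ∧ t β →
    HoldsEventually t β
  last : ∀ β, α = β + 1 → ¬ t β
  end_lim : Order.IsSuccLimit α →
    ¬ (HoldsEventually (fun x => ¬ q x) α ∧ HoldsEventually p α ∧ HoldsEventually t α)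

/-- The local conditions that determine strict "since" on the ordinals below `α`. -/
structure IsSince (α : Ordinal.{u}) (p q t : Ordinal.{u} → Prop) : Prop where
  zero : ¬ t 0
  succ : ∀ β, β + 1 < α → (t (β + 1) ↔ q β ∨ p β ∧ t β)
  lim : ∀ β < α, Order.IsSuccLimit β → (t β ↔ HoldsEventually p β ∧ HoldsEventually t β)

variable {α β : Ordinal.{u}} {p q t p' q' t' : Ordinal.{u} → Prop}

theorem HoldsEventually.and (h1 : HoldsEventually p β) (h2 : HoldsEventually q β) :
    HoldsEventually (fun x => p x ∧ q x) β := by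
  obtain ⟨γ, hγ, H⟩ := h1
  obtain ⟨γ', hγ', H'⟩ := h2
  exact ⟨max γ γ', max_lt hγ hγ', fun x h1 h2 =>
    ⟨H x ((le_max_left _ _).trans_lt h1) h2, H' x ((le_max_right _ _).trans_lt h1) h2⟩⟩

theorem HoldsEventually.exists_gt (hβ : Order.IsSuccLimit β) (h : HoldsEventually p β)
    {γ : Ordinal.{u}} (hγ : γ < β) : ∃ x, γ < x ∧ x < β ∧ ∀ y, x ≤ y → y < β → p y := by
  obtain ⟨γ', hγ', H⟩ := h
  refine ⟨max γ γ' + 1, ?_, hβ.add_one_lt (max_lt hγ hγ'), fun y h1 h2 => H y ?_ h2⟩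
  · exact (le_max_left _ _).trans_lt (lt_add_one _)
  · exact ((le_max_right _ _).trans_lt (lt_add_one _)).trans_le h1

theorem untilBelow_congr (hp : ∀ x < α, p x ↔ p' x) (hq : ∀ x < α, q x ↔ q' x) :
    UntilBelow α p q β ↔ UntilBelow α p' q' β := by
  constructor
  · rintro ⟨γ, h1, h2, h3, h4⟩
    exact ⟨γ, h1, h2, (hq _ h2).1 h3, fun x h5 h6 => (hp _ (h6.trans h2)).1 (h4 x h5 h6)⟩
  · rintro ⟨γ, h1, h2, h3, h4⟩
    exact ⟨γ, h1, h2, (hq _ h2).2 h3, fun x h5 h6 => (hp _ (h6.trans h2)).2 (h4 x h5 h6)⟩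

theorem sinceBelow_congr (hp : ∀ x < β, p x ↔ p' x) (hq : ∀ x < β, q x ↔ q' x) :
    SinceBelow p q β ↔ SinceBelow p' q' β := by
  constructor
  · rintro ⟨γ, h1, h3, h4⟩
    exact ⟨γ, h1, (hq _ h1).1 h3, fun x h5 h6 => (hp _ h6).1 (h4 x h5 h6)⟩
  · rintro ⟨γ, h1, h3, h4⟩
    exact ⟨γ, h1, (hq _ h1).2 h3, fun x h5 h6 => (hp _ h6).2 (h4 x h5 h6)⟩

/-- The limit clauses have to be one-sided. If p holds eventually and q cofinally below β, until
holds eventually below β whatever happens from β on; if p fails cofinally, the future of β has no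
influence at all. -/
theorem isUntil_untilBelow (α : Ordinal.{u}) (p q : Ordinal.{u} → Prop) :
    IsUntil α p q (UntilBelow α p q) where
  succ β hβ := by
    constructor
    · rintro ⟨γ, h1, h2, h3, h4⟩
      rcases (Order.add_one_le_of_lt h1).eq_or_lt with rfl | h
      · exact .inl h3
      · exact .inr ⟨h4 _ (lt_add_one β) h, γ, h, h2, h3, fun x h5 h6 =>
          h4 x ((lt_add_one β).trans h5) h6⟩
    · rintro (h | ⟨h, γ, h1, h2, h3, h4⟩)
      · exact ⟨β + 1, lt_add_one β, hβ, h, fun x h1 h2 =>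
          (h2.not_ge (Order.add_one_le_of_lt h1)).elim⟩
      · refine ⟨γ, (lt_add_one β).trans h1, h2, h3, fun x h5 h6 => ?_⟩
        rcases (Order.add_one_le_of_lt h5).eq_or_lt with rfl | h7
        · exact h
        · exact h4 x h7 h6
  lim_right β hβ hl hq hp ht := by
    obtain ⟨x, -, hx, H⟩ := ((hq.and hp).and ht).exists_gt hl hl.bot_lt
    obtain ⟨γ, h1, h2, h3, h4⟩ := (H x le_rfl hx).2
    rcases lt_trichotomy γ β with h | rfl | h
    · exact ((H γ h1.le h).1.1 h3).elim
    · exact .inl h3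
    · exact .inr ⟨h4 β hx h, γ, h, h2, h3, fun y h5 h6 => h4 y (hx.trans h5) h6⟩
  lim_left β hβ hl hp h := by
    obtain ⟨δ, hδ, H⟩ := hp
    rcases h with h | ⟨h, γ, h1, h2, h3, h4⟩
    · exact ⟨δ, hδ, fun x h5 h6 => ⟨β, h6, hβ, h, fun y h7 h8 => H y (h5.trans h7) h8⟩⟩
    · refine ⟨δ, hδ, fun x h5 h6 => ⟨γ, h6.trans h1, h2, h3, fun y h7 h8 => ?_⟩⟩
      rcases lt_trichotomy y β with h9 | rfl | h9
      · exact H y (h5.trans h7) h9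
      · exact h
      · exact h4 y h9 h8
  last β hβ := by
    rintro ⟨γ, h1, h2, -⟩
    rw [hβ] at h2
    exact h2.not_ge (Order.add_one_le_of_lt h1)
  end_lim hl := by
    rintro ⟨hq, -, ht⟩
    obtain ⟨x, -, hx, H⟩ := (hq.and ht).exists_gt hl hl.bot_lt
    obtain ⟨γ, h1, h2, h3, -⟩ := (H x le_rfl hx).2
    exact (H γ h1.le h2).1 h3

theorem IsUntil.iff (h : IsUntil α p q t) (hβ : β < α) : t β ↔ UntilBelow α p q β := by
  constructor
  · intro ht
    by_contra hn
    -- An unfulfilled t β is propagated to all later positions and contradicts the condition at the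
    -- end.
    have key : ∀ γ, β < γ → γ < α → ¬ q γ ∧ p γ ∧ t γ := by
      intro γ
      induction γ using WellFoundedLT.induction with
      | ind γ ih =>
        intro h1 h2
        have hq : ¬ q γ := fun hq => hn ⟨γ, h1, h2, hq, fun x h3 h4 =>
          (ih x h4 h3 (h4.trans h2)).2.1⟩
        refine ⟨hq, ?_⟩
        rcases Ordinal.zero_or_succ_or_isSuccLimit γ with rfl | ⟨γ, rfl⟩ | hl
        · exact (not_lt_zero h1).elim
        · rw [Order.succ_eq_add_one] at *
          have htγ : t γ := by
            rcases (Order.lt_add_one_iff.1 h1).eq_or_lt with rfl | h3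
            · exact ht
            · exact (ih γ (lt_add_one γ) h3 ((lt_add_one γ).trans h2)).2.2
          exact ((h.succ γ h2).1 htγ).resolve_left hq
        · exact (h.lim_right γ h2 hl ⟨β, h1, fun x h3 h4 => (ih x h4 h3 (h4.trans h2)).1⟩
            ⟨β, h1, fun x h3 h4 => (ih x h4 h3 (h4.trans h2)).2.1⟩
            ⟨β, h1, fun x h3 h4 => (ih x h4 h3 (h4.trans h2)).2.2⟩).resolve_left hq
    rcases Ordinal.zero_or_succ_or_isSuccLimit α with rfl | ⟨α, rfl⟩ | hl
    · exact not_lt_zero hβ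
    · rw [Order.succ_eq_add_one] at *
      refine h.last α rfl ?_
      rcases (Order.lt_add_one_iff.1 hβ).eq_or_lt with rfl | h3
      · exact ht
      · exact (key α h3 (lt_add_one α)).2.2
    · exact h.end_lim hl ⟨⟨β, hβ, fun x h3 h4 => (key x h3 h4).1⟩,
        ⟨β, hβ, fun x h3 h4 => (key x h3 h4).2.1⟩, ⟨β, hβ, fun x h3 h4 => (key x h3 h4).2.2⟩⟩
  · rintro ⟨γ, h1, h2, h3, h4⟩
    -- The witness is moved down towards β. The disjunction makes the claim inductive: after one
    -- move, t has replaced q.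
    have key : ∀ γ, β < γ → γ < α → q γ ∨ p γ ∧ t γ → (∀ x, β < x → x < γ → p x) → t β := by
      intro γ
      induction γ using WellFoundedLT.induction with
      | ind γ ih =>
        intro h1 h2 h3 h4
        rcases Ordinal.zero_or_succ_or_isSuccLimit γ with rfl | ⟨γ, rfl⟩ | hl
        · exact (not_lt_zero h1).elim
        · rw [Order.succ_eq_add_one] at *
          have htγ := (h.succ γ h2).2 h3
          rcases (Order.lt_add_one_iff.1 h1).eq_or_lt with rfl | h5
          · exact htγ
          · exact ih γ (lt_add_one γ) h5 ((lt_add_one γ).trans h2)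
              (.inr ⟨h4 γ h5 (lt_add_one γ), htγ⟩) fun x h6 h7 => h4 x h6 (h7.trans (lt_add_one γ))
        · have ht := h.lim_left γ h2 hl ⟨β, h1, h4⟩ h3
          obtain ⟨x, hx1, hx2, H⟩ := ht.exists_gt hl h1
          exact ih x hx2 hx1 (hx2.trans h2) (.inr ⟨h4 x hx1 hx2, H x le_rfl hx2⟩)
            fun y h6 h7 => h4 y h6 (h7.trans hx2)
    exact key γ h1 h2 (.inl h3) h4

theorem isSince_sinceBelow (α : Ordinal.{u}) (p q : Ordinal.{u} → Prop) :
    IsSince α p q (SinceBelow p q) where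
  zero := fun ⟨_, h, _⟩ => not_lt_zero h
  succ β hβ := by
    constructor
    · rintro ⟨γ, h1, h3, h4⟩
      rcases (Order.lt_add_one_iff.1 h1).eq_or_lt with rfl | h
      · exact .inl h3
      · exact .inr ⟨h4 _ h (lt_add_one β), γ, h, h3, fun x h5 h6 =>
          h4 x h5 (h6.trans (lt_add_one β))⟩
    · rintro (h | ⟨h, γ, h1, h3, h4⟩)
      · exact ⟨β, lt_add_one β, h, fun x h1 h2 =>
          (h2.not_ge (Order.add_one_le_of_lt h1)).elim⟩
      · refine ⟨γ, h1.trans (lt_add_one β), h3, fun x h5 h6 => ?_⟩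
        rcases (Order.lt_add_one_iff.1 h6).eq_or_lt with rfl | h7
        · exact h
        · exact h4 x h5 h7
  lim β hβ hl := by
    constructor
    · rintro ⟨γ, h1, h3, h4⟩
      exact ⟨⟨γ, h1, h4⟩, γ, h1, fun x h5 h6 => ⟨γ, h5, h3, fun y h7 h8 => h4 y h7 (h8.trans h6)⟩⟩
    · rintro ⟨hp, ht⟩
      obtain ⟨x, -, hx, H⟩ := (hp.and ht).exists_gt hl hl.bot_lt
      obtain ⟨γ, h1, h3, h4⟩ := (H x le_rfl hx).2
      refine ⟨γ, h1.trans hx, h3, fun y h5 h6 => ?_⟩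
      rcases lt_or_ge y x with h | h
      · exact h4 y h5 h
      · exact (H y h h6).1

/-- The conditions determine t at each position from smaller positions, so they have at most one
solution, and since is one. -/
theorem IsSince.iff (h : IsSince α p q t) (hβ : β < α) : t β ↔ SinceBelow p q β := by
  have hs := isSince_sinceBelow α p q
  induction β using WellFoundedLT.induction with
  | ind β ih =>
    rcases Ordinal.zero_or_succ_or_isSuccLimit β with rfl | ⟨β, rfl⟩ | hl
    · exact iff_of_false h.zero hs.zero
    · rw [Order.succ_eq_add_one] at *
      have hlt := lt_add_one β
      exact (h.succ β hβ).trans ((or_congr_right (and_congr_right fun _ =>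
        ih β hlt (hlt.trans hβ))).trans (hs.succ β hβ).symm)
    · rw [h.lim β hβ hl, hs.lim β hβ hl]
      refine and_congr_right fun _ => exists_congr fun γ => and_congr_right fun _ =>
        forall_congr' fun x => forall₂_congr fun _ hx => ih x hx (hx.trans hβ)

theorem IsSince.congr (h : IsSince α p q t) (hp : ∀ x, p x ↔ p' x) (hq : ∀ x, q x ↔ q' x)
    (ht : ∀ x, t x ↔ t' x) : IsSince α p' q' t' := by
  rwa [← funext fun x => propext (hp x), ← funext fun x => propext (hq x),
    ← funext fun x => propext (ht x)]

theorem IsUntil.congr (h : IsUntil α p q t) (hp : ∀ x, p x ↔ p' x) (hq : ∀ x, q x ↔ q' x)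
    (ht : ∀ x, t x ↔ t' x) : IsUntil α p' q' t' := by
  rwa [← funext fun x => propext (hp x), ← funext fun x => propext (hq x),
    ← funext fun x => propext (ht x)]

end TemporalOperators

/-! ### The automaton of a formula. -/

namespace LTLFormula

variable {AP : Type w}

theorem mem_subformulas_self (φ : LTLFormula AP) : φ ∈ subformulas φ := by
  cases φ <;> simp [subformulas]

theorem subformulas_subset {φ ψ : LTLFormula AP} (h : ψ ∈ subformulas φ) :
    subformulas ψ ⊆ subformulas φ := by
  induction φ with
  | atom p => rw [Set.mem_singleton_iff.1 h]
  | neg φ ih =>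
    rcases h with rfl | h
    · rfl
    · exact (ih h).trans (Set.subset_insert _ _)
  | and φ₁ φ₂ ih₁ ih₂ | U φ₁ φ₂ ih₁ ih₂ | S φ₁ φ₂ ih₁ ih₂ =>
    rcases h with rfl | h | h
    · rfl
    · exact (ih₁ h).trans (Set.subset_union_left.trans (Set.subset_insert _ _))
    · exact (ih₂ h).trans (Set.subset_union_right.trans (Set.subset_insert _ _))

variable {φ a b : LTLFormula AP}

theorem mem_of_neg (h : neg a ∈ subformulas φ) : a ∈ subformulas φ :=
  subformulas_subset h (.inr (mem_subformulas_self a))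

theorem mem_of_and (h : and a b ∈ subformulas φ) : a ∈ subformulas φ ∧ b ∈ subformulas φ :=
  ⟨subformulas_subset h (.inr (.inl (mem_subformulas_self a))),
    subformulas_subset h (.inr (.inr (mem_subformulas_self b)))⟩

theorem mem_of_U (h : U a b ∈ subformulas φ) : a ∈ subformulas φ ∧ b ∈ subformulas φ :=
  ⟨subformulas_subset h (.inr (.inl (mem_subformulas_self a))),
    subformulas_subset h (.inr (.inr (mem_subformulas_self b)))⟩

theorem mem_of_S (h : S a b ∈ subformulas φ) : a ∈ subformulas φ ∧ b ∈ subformulas φ :=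
  ⟨subformulas_subset h (.inr (.inl (mem_subformulas_self a))),
    subformulas_subset h (.inr (.inr (mem_subformulas_self b)))⟩

theorem norm_mem_sub (h : a ∈ subformulas φ) : norm a ∈ sub φ := ⟨a, .inl h, rfl⟩

theorem norm_neg_mem_sub (h : a ∈ subformulas φ) : norm (neg a) ∈ sub φ :=
  ⟨neg a, .inr ⟨a, h, rfl⟩, rfl⟩

/-- Satisfaction for models that are given by total functions on the ordinals. -/
def SatBelow (σ : Ordinal.{u} → Set AP) (α : Ordinal.{u}) : LTLFormula AP → Ordinal.{u} → Prop
  | atom p => fun β => p ∈ σ β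
  | neg φ => fun β => ¬ SatBelow σ α φ β
  | and φ ψ => fun β => SatBelow σ α φ β ∧ SatBelow σ α ψ β
  | U φ ψ => UntilBelow α (SatBelow σ α φ) (SatBelow σ α ψ)
  | S φ ψ => SinceBelow (SatBelow σ α φ) (SatBelow σ α ψ)

theorem sat_iff_satBelow (σ : Ordinal.{u} → Set AP) {α : Ordinal.{u}} (φ : LTLFormula AP)
    (β : Set.Iio α) : Sat (fun x : Set.Iio α => σ x.1) β φ ↔ SatBelow σ α φ β.1 := by
  induction φ generalizing β with
  | atom p => rw [Sat, SatBelow]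
  | neg φ ih => rw [Sat, SatBelow, ih]
  | and φ ψ ih₁ ih₂ => rw [Sat, SatBelow, ih₁, ih₂]
  | U φ ψ ih₁ ih₂ =>
    rw [Sat, SatBelow]
    constructor
    · rintro ⟨γ, h1, h2, h3⟩
      exact ⟨γ.1, h1, γ.2, (ih₂ _).1 h2, fun x h4 h5 =>
        (ih₁ ⟨x, h5.trans γ.2⟩).1 (h3 ⟨x, h5.trans γ.2⟩ h4 h5)⟩
    · rintro ⟨γ, h1, h2, h3, h4⟩
      exact ⟨⟨γ, h2⟩, h1, (ih₂ _).2 h3, fun x h5 h6 => (ih₁ _).2 (h4 x.1 h5 h6)⟩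
  | S φ ψ ih₁ ih₂ =>
    rw [Sat, SatBelow]
    constructor
    · rintro ⟨γ, h1, h2, h3⟩
      exact ⟨γ.1, h1, (ih₂ _).1 h2, fun x h4 h5 =>
        (ih₁ ⟨x, h5.trans β.2⟩).1 (h3 ⟨x, h5.trans β.2⟩ h4 h5)⟩
    · rintro ⟨γ, h1, h3, h4⟩
      exact ⟨⟨γ, h1.trans β.2⟩, h1, (ih₂ _).2 h3, fun x h5 h6 => (ih₁ _).2 (h4 x.1 h5 h6)⟩

theorem hasModel_iff_satBelow {φ : LTLFormula AP} {α : Ordinal.{u}} :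
    φ.HasModel α ↔ 0 < α ∧ ∃ σ : Ordinal.{u} → Set AP, SatBelow σ α φ 0 := by
  constructor
  · rintro ⟨h, τ, H⟩
    obtain ⟨σ, rfl⟩ := exists_extend τ
    exact ⟨h, σ, (sat_iff_satBelow σ φ ⟨0, h⟩).1 H⟩
  · rintro ⟨h, σ, H⟩
    exact ⟨h, fun x => σ x.1, (sat_iff_satBelow σ φ ⟨0, h⟩).2 H⟩

theorem satBelow_cneg (σ : Ordinal.{u} → Set AP) (α : Ordinal.{u}) (φ : LTLFormula AP)
    (β : Ordinal.{u}) : SatBelow σ α (cneg φ) β ↔ ¬ SatBelow σ α φ β := by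
  cases φ <;> simp [cneg, SatBelow]

theorem satBelow_norm (σ : Ordinal.{u} → Set AP) (α : Ordinal.{u}) (φ : LTLFormula AP)
    (β : Ordinal.{u}) : SatBelow σ α (norm φ) β ↔ SatBelow σ α φ β := by
  induction φ generalizing β with
  | atom p => rfl
  | neg φ ih => rw [norm, satBelow_cneg, SatBelow, ih]
  | and φ ψ ih₁ ih₂ => exact and_congr (ih₁ β) (ih₂ β)
  | U φ ψ ih₁ ih₂ => exact untilBelow_congr (fun x _ => ih₁ x) fun x _ => ih₂ x
  | S φ ψ ih₁ ih₂ => exact sinceBelow_congr (fun x _ => ih₁ x) fun x _ => ih₂ x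

/-- The representative of `ψ` belongs to `X`. -/
def Holds (X : Set (sub φ)) (ψ : LTLFormula AP) : Prop :=
  ∃ x ∈ X, x.1 = norm ψ

theorem holds_iff {ψ : LTLFormula AP} (h : norm ψ ∈ sub φ) (X : Set (sub φ)) :
    Holds X ψ ↔ ⟨norm ψ, h⟩ ∈ X := by
  constructor
  · rintro ⟨⟨x, hx⟩, h1, rfl⟩
    exact h1
  · exact fun h1 => ⟨_, h1, rfl⟩

/-- Lets limit transitions speak about what holds eventually in a run. -/
theorem holds_eventualSet {ψ : LTLFormula AP} (h : norm ψ ∈ sub φ)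
    (r : Ordinal.{u} → Set (sub φ)) (β : Ordinal.{u}) :
    Holds (eventualSet r β) ψ ↔ HoldsEventually (fun x => Holds (r x) ψ) β := by
  simp only [holds_iff h]
  rfl

/-- `X` treats the Boolean connectives correctly. -/
structure Consistent (φ : LTLFormula AP) (X : Set (sub φ)) : Prop where
  neg : ∀ a ∈ subformulas φ, (Holds X (neg a) ↔ ¬ Holds X a)
  and : ∀ a b, and a b ∈ subformulas φ → (Holds X (and a b) ↔ Holds X a ∧ Holds X b)

/-- The automaton whose accepting runs are the models of `φ`, labelled by the true elements of
`sub φ`. -/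
def automaton (φ : LTLFormula AP) : AcceptingOrdinalAutomaton (sub φ) where
  Q := {X | Consistent φ X}
  next := {P | (Consistent φ P.1 ∧ Consistent φ P.2) ∧
    (∀ a b, U a b ∈ subformulas φ →
      (Holds P.1 (U a b) ↔ Holds P.2 b ∨ Holds P.2 a ∧ Holds P.2 (U a b))) ∧
    ∀ a b, S a b ∈ subformulas φ →
      (Holds P.2 (S a b) ↔ Holds P.1 b ∨ Holds P.1 a ∧ Holds P.1 (S a b))}
  next_subset := fun _ h => h.1
  lim := {P | Consistent φ P.2 ∧
    (∀ a b, U a b ∈ subformulas φ →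
      (Holds P.1 (neg b) → Holds P.1 a → Holds P.1 (U a b) →
        Holds P.2 b ∨ Holds P.2 a ∧ Holds P.2 (U a b)) ∧
      (Holds P.1 a → Holds P.2 b ∨ Holds P.2 a ∧ Holds P.2 (U a b) → Holds P.1 (U a b))) ∧
    ∀ a b, S a b ∈ subformulas φ →
      (Holds P.2 (S a b) ↔ Holds P.1 a ∧ Holds P.1 (S a b))}
  lim_subset := fun _ h => ⟨trivial, h.1⟩
  I := {X | Consistent φ X ∧ Holds X φ ∧ ∀ a b, S a b ∈ subformulas φ → ¬ Holds X (S a b)}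
  I_subset := fun _ h => h.1
  F := {X | Consistent φ X ∧ ∀ a b, U a b ∈ subformulas φ → ¬ Holds X (U a b)}
  F_subset := fun _ h => h.1
  limF := {X | ∀ a b, U a b ∈ subformulas φ →
    ¬ (Holds X (neg b) ∧ Holds X a ∧ Holds X (U a b))}

theorem automaton_hasAcceptingRun_iff (φ : LTLFormula AP) (α : Ordinal.{u}) :
    (automaton φ).HasAcceptingRun α ↔ 0 < α ∧ ∃ r : Ordinal.{u} → Set (sub φ),
      (∀ β < α, Consistent φ (r β)) ∧ Holds (r 0) φ ∧
      (∀ a b, U a b ∈ subformulas φ → IsUntil α (fun x => Holds (r x) a) (fun x => Holds (r x) b)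
        fun x => Holds (r x) (U a b)) ∧
      ∀ a b, S a b ∈ subformulas φ → IsSince α (fun x => Holds (r x) a) (fun x => Holds (r x) b)
        fun x => Holds (r x) (S a b) := by
  -- A limit set need not be consistent: lacking b there does not mean that b eventually fails. This
  -- is why the basis contains negations.
  have hneg : ∀ {r : Ordinal.{u} → Set (sub φ)}, (∀ β < α, Consistent φ (r β)) →
      ∀ {b}, b ∈ subformulas φ → ∀ β ≤ α,
        (Holds (eventualSet r β) (neg b) ↔ HoldsEventually (fun x => ¬ Holds (r x) b) β) := by
    intro r hr b hb β hβ
    rw [holds_eventualSet (norm_neg_mem_sub hb)]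
    exact exists_congr fun γ => and_congr_right fun _ => forall_congr' fun x =>
      forall₂_congr fun _ hx => (hr x (hx.trans_le hβ)).neg b hb
  rw [AcceptingOrdinalAutomaton.hasAcceptingRun_iff]
  constructor
  · rintro ⟨r, h0, hp, hI, hF, hL⟩
    have hc : ∀ β < α, Consistent φ (r β) := hp.mem_Q
    refine ⟨h0, r, hc, hI.2.1, fun a b hab => ?_, fun a b hab => ?_⟩
    · obtain ⟨ha, hb⟩ := mem_of_U hab
      refine ⟨fun β hβ => (hp.next_mem β hβ).2.1 a b hab, fun β hβ hl h1 h2 h3 => ?_,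
        fun β hβ hl h1 h2 => ?_, fun β hβ => (hF β hβ).2 a b hab, fun hl => ?_⟩
      · refine ((hp.lim_mem β hβ hl).2.1 a b hab).1 ((hneg hc hb β hβ.le).2 h1)
          ((holds_eventualSet (norm_mem_sub ha) r β).2 h2)
          ((holds_eventualSet (norm_mem_sub hab) r β).2 h3)
      · exact (holds_eventualSet (norm_mem_sub hab) r β).1 (((hp.lim_mem β hβ hl).2.1 a b hab).2
          ((holds_eventualSet (norm_mem_sub ha) r β).2 h1) h2)
      · have := hL hl a b hab
        rwa [hneg hc hb α le_rfl, holds_eventualSet (norm_mem_sub ha),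
          holds_eventualSet (norm_mem_sub hab)] at this
    · obtain ⟨ha, hb⟩ := mem_of_S hab
      refine ⟨hI.2.2 a b hab, fun β hβ => (hp.next_mem β hβ).2.2 a b hab, fun β hβ hl => ?_⟩
      have := (hp.lim_mem β hβ hl).2.2 a b hab
      rwa [holds_eventualSet (norm_mem_sub ha), holds_eventualSet (norm_mem_sub hab)] at this
  · rintro ⟨h0, r, hc, hφ, hU, hS⟩
    refine ⟨r, h0, ⟨hc, fun β hβ => ⟨⟨hc _ (lt_of_le_of_lt le_self_add hβ), hc _ hβ⟩,
      fun a b hab => (hU a b hab).succ β hβ, fun a b hab => (hS a b hab).succ β hβ⟩,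
      fun β hβ hl => ⟨hc β hβ, fun a b hab => ?_, fun a b hab => ?_⟩⟩,
      ⟨hc 0 h0, hφ, fun a b hab => (hS a b hab).zero⟩,
      fun β hβ => ⟨hc β (hβ ▸ lt_add_one β), fun a b hab => (hU a b hab).last β hβ⟩,
      fun hl a b hab => ?_⟩
    · obtain ⟨ha, hb⟩ := mem_of_U hab
      rw [hneg hc hb β hβ.le, holds_eventualSet (norm_mem_sub ha),
        holds_eventualSet (norm_mem_sub hab)]
      exact ⟨(hU a b hab).lim_right β hβ hl, (hU a b hab).lim_left β hβ hl⟩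
    · obtain ⟨ha, hb⟩ := mem_of_S hab
      rw [holds_eventualSet (norm_mem_sub ha), holds_eventualSet (norm_mem_sub hab)]
      exact (hS a b hab).lim β hβ hl
    · obtain ⟨ha, hb⟩ := mem_of_U hab
      rw [hneg hc hb α le_rfl, holds_eventualSet (norm_mem_sub ha),
        holds_eventualSet (norm_mem_sub hab)]
      exact (hU a b hab).end_lim hl

/-- A model yields the run of true formulae; a run yields a model by reading off the atoms, and
induction on subformulae shows that its labels are correct. -/
theorem hasModel_iff_hasAcceptingRun (φ : LTLFormula AP) (α : Ordinal.{u}) :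
    φ.HasModel α ↔ (automaton φ).HasAcceptingRun α := by
  rw [hasModel_iff_satBelow, automaton_hasAcceptingRun_iff]
  refine and_congr_right fun h0 => ⟨?_, ?_⟩
  · rintro ⟨σ, hσ⟩
    let r : Ordinal.{u} → Set (sub φ) := fun x => {y | SatBelow σ α y.1 x}
    have hr : ∀ {ψ}, norm ψ ∈ sub φ → ∀ x, Holds (r x) ψ ↔ SatBelow σ α ψ x := fun h x =>
      (holds_iff h _).trans (satBelow_norm σ α _ x)
    refine ⟨r, fun β _ => ⟨fun a ha => ?_, fun a b hab => ?_⟩, ?_, fun a b hab => ?_,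
      fun a b hab => ?_⟩
    · rw [hr (norm_neg_mem_sub ha), hr (norm_mem_sub ha), SatBelow]
    · obtain ⟨ha, hb⟩ := mem_of_and hab
      rw [hr (norm_mem_sub hab), hr (norm_mem_sub ha), hr (norm_mem_sub hb), SatBelow]
    · exact (hr (norm_mem_sub (mem_subformulas_self φ)) 0).2 hσ
    · obtain ⟨ha, hb⟩ := mem_of_U hab
      exact (isUntil_untilBelow α _ _).congr (fun x => (hr (norm_mem_sub ha) x).symm)
        (fun x => (hr (norm_mem_sub hb) x).symm) fun x => (hr (norm_mem_sub hab) x).symm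
    · obtain ⟨ha, hb⟩ := mem_of_S hab
      exact (isSince_sinceBelow α _ _).congr (fun x => (hr (norm_mem_sub ha) x).symm)
        (fun x => (hr (norm_mem_sub hb) x).symm) fun x => (hr (norm_mem_sub hab) x).symm
  · rintro ⟨r, hc, hφ, hU, hS⟩
    let σ : Ordinal.{u} → Set AP := fun x => {p | Holds (r x) (atom p)}
    have key : ∀ ψ ∈ subformulas φ, ∀ β < α, (Holds (r β) ψ ↔ SatBelow σ α ψ β) := by
      intro ψ
      induction ψ with
      | atom p => exact fun _ _ _ => Iff.rfl
      | neg a ih =>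
        intro h β hβ
        rw [(hc β hβ).neg a (mem_of_neg h), ih (mem_of_neg h) β hβ, SatBelow]
      | and a b ih₁ ih₂ =>
        intro h β hβ
        rw [(hc β hβ).and a b h, ih₁ (mem_of_and h).1 β hβ, ih₂ (mem_of_and h).2 β hβ, SatBelow]
      | U a b ih₁ ih₂ =>
        intro h β hβ
        exact ((hU a b h).iff hβ).trans (untilBelow_congr (ih₁ (mem_of_U h).1) (ih₂ (mem_of_U h).2))
      | S a b ih₁ ih₂ =>
        intro h β hβ
        exact ((hS a b h).iff hβ).trans (sinceBelow_congr
          (fun x hx => ih₁ (mem_of_S h).1 x (hx.trans hβ))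
          fun x hx => ih₂ (mem_of_S h).2 x (hx.trans hβ))
    exact ⟨σ, (key φ (mem_subformulas_self φ) 0 h0).1 hφ⟩

end LTLFormula

theorem lemma2p7 :
    -- (I)
    (∀ (B : Type v) [Finite B] (A : AcceptingOrdinalAutomaton B) (α β : Ordinal.{u}),
      α.card ≤ ℵ₀ → β.card ≤ ℵ₀ → OrdEquiv (Nat.card B + 2) α β →
        (A.HasAcceptingRun α ↔ A.HasAcceptingRun β)) ∧
    -- (II)
    (∀ (AP : Type w) (φ : LTLFormula AP) (α β : Ordinal.{u}),
      α.card ≤ ℵ₀ → β.card ≤ ℵ₀ → OrdEquiv (φ.size + 2) α β →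
        (φ.HasModel α ↔ φ.HasModel β)) := by
  refine ⟨fun B _ A α β hα hβ h => A.hasAcceptingRun_congr hα hβ h, fun AP φ α β hα hβ h => ?_⟩
  have : Finite φ.sub := φ.finite_sub
  rw [φ.hasModel_iff_hasAcceptingRun, φ.hasModel_iff_hasAcceptingRun]
  -- `φ.size` unfolds to the cardinality of the basis `φ.sub`.
  exact φ.automaton.hasAcceptingRun_congr hα hβ h
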